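/- Let $(M,J,g)$ and $(\tilde M,\tilde J,\tilde g)$ be almost Hermitian manifolds: smooth (Hausdorff, finite-dimensional, without boundary) manifolds with smooth almost complex structures and smooth Riemannian metrics satisfying $g(JX,JY)=g(X,Y)$, $\tilde g(\tilde JX,\tilde JY)=\tilde g(X,Y)$. Each carries its canonical connection $\nabla$, that is, the unique affine connection with $\nabla g=0$, $\nabla J=0$ whose torsion has vanishing $(1,1)$-part. With $R(X,Y)Z=\nabla_X\nabla_YZ-\nabla_Y\nabla_XZ-\nabla_{[X,Y]}Z$, the holomorphic sectional curvature in the direction of a $(1,0)$-vector $Z=X-\sqrt{-1}\,JX\neq 0$ is $$\frac{g(R(Z,\bar Z)Z,\bar Z)}{g(Z,\bar Z)^2}=\frac{g(R(X,JX)JX,X)}{g(X,X)^2}.$$ A continuous function $u:M\to\mathbb R$ is a tamed exhaustion function if $u\ge 0$, the set $u^{-1}((-\infty,c])$ is compact for every $c\in\mathbb R$, and there is a constant $C>0$ such that for every $p\in M$ there are an open neighbourhood $V$ of $p$ and a $C^2$ function $v:V\to\mathbb R$ with $v\ge u$ on $V$, $v(p)=u(p)$, $\|\nabla v\|(p)\le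 C$, and $(\nabla dv)_p(Z,\bar Z)\le C\,g_p(Z,\bar Z)$ for all $(1,0)$-vectors $Z$ at $p$, where $(\nabla dv)(X,Y)=Y(Xv)-(\nabla_YX)v$. Let $k_1\ge 0$ and $k_2>0$. Assume that the holomorphic sectional curvature of $M$ is everywhere at least $-k_1$, that the holomorphic sectional curvature of $\tilde M$ is everywhere at most $-k_2$, and that $M$ admits a tamed exhaustion function. Then every almost holomorphic map $f:M\to\tilde M$, i.e. every smooth map with $df\circ J=\tilde J\circ df$, satisfies $$f^*\tilde g\le\frac{k_1}{k_2}\,g .$$ In particular, if $k_1=0$ and $M$ is connected, then every almost holomorphic map $f:M\to\tilde M$ is constant. -/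

import Mathlib

open Bundle
open scoped Manifold ContDiff

section AlmostHermitian

set_option linter.unusedSectionVars false

variable {E : Type*} [NormedAddCommGroup E] [NormedSpace ℝ E]
  {M : Type*} [TopologicalSpace M] [ChartedSpace E M] [IsManifold 𝓘(ℝ, E) ∞ M]
  [RiemannianBundle (fun x : M ↦ TangentSpace 𝓘(ℝ, E) x)]

variable (E M) in
/-- A smooth almost complex structure `J` on `M` compatible with the given Riemannian metric
`g = inner ℝ` on the tangent bundle: `J² = -1` and `g(JX, JY) = g(X, Y)`. -/
structure AlmostHermitianStructure where
  /-- the almost complex structure -/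
  J : ∀ x : M, TangentSpace 𝓘(ℝ, E) x →L[ℝ] TangentSpace 𝓘(ℝ, E) x
  J_sq : ∀ (x : M) (v : TangentSpace 𝓘(ℝ, E) x), J x (J x v) = -v
  inner_J : ∀ (x : M) (v w : TangentSpace 𝓘(ℝ, E) x),
    inner ℝ (J x v) (J x w) = inner ℝ v w
  contMDiff_J : ContMDiff 𝓘(ℝ, E) (𝓘(ℝ, E).prod 𝓘(ℝ, E →L[ℝ] E)) ∞
    (fun x ↦ TotalSpace.mk' (E →L[ℝ] E)
      (E := fun x : M ↦ TangentSpace 𝓘(ℝ, E) x →L[ℝ] TangentSpace 𝓘(ℝ, E) x) x (J x))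

namespace AlmostHermitianStructure

variable [FiniteDimensional ℝ E]
  [IsContMDiffRiemannianBundle 𝓘(ℝ, E) ∞ E (fun x : M ↦ TangentSpace 𝓘(ℝ, E) x)]
variable (S : AlmostHermitianStructure E M)

/-- `D` is the canonical connection: `∇g = 0`, `∇J = 0`, and the `(1,1)`-part of the torsion `τ`
vanishes. (`D Y x v` is `∇_v Y` at `x`.) The last condition means `τ(Z, W̄) = 0` for all `(1,0)`
vectors `Z = X - iJX`, `W = Y - iJY`; its real and imaginary parts are written out. -/
structure IsCanonicalConnection
    (D : CovariantDerivative 𝓘(ℝ, E) E (TangentSpace 𝓘(ℝ, E) : M → Type _)) : Prop where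
  metric : ∀ (x : M) (Y Z : ∀ y : M, TangentSpace 𝓘(ℝ, E) y),
    MDiffAt (T% Y) x → MDiffAt (T% Z) x → ∀ v : TangentSpace 𝓘(ℝ, E) x,
      mvfderiv 𝓘(ℝ, E) (fun y ↦ inner ℝ (Y y) (Z y)) x v =
        inner ℝ (D Y x v) (Z x) + inner ℝ (Y x) (D Z x v)
  parallel : ∀ (x : M) (Y : ∀ y : M, TangentSpace 𝓘(ℝ, E) y), MDiffAt (T% Y) x →
    ∀ v : TangentSpace 𝓘(ℝ, E) x, D (fun y ↦ S.J y (Y y)) x v = S.J x (D Y x v)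
  torsion : haveI := FiniteDimensional.complete ℝ E
    ∀ (x : M) (v w : TangentSpace 𝓘(ℝ, E) x),
      D.torsion x v w + D.torsion x (S.J x v) (S.J x w) = 0 ∧
      D.torsion x v (S.J x w) - D.torsion x (S.J x v) w = 0

/-! ### Existence and uniqueness of the canonical connection -/

variable {X X' Y Z : ∀ y : M, TangentSpace 𝓘(ℝ, E) y} {x : M} {f : M → ℝ}

/-- The vector field `JX`. -/
noncomputable def applyJ (X : ∀ y : M, TangentSpace 𝓘(ℝ, E) y) : ∀ y : M, TangentSpace 𝓘(ℝ, E) y := fun y ↦ S.J y (X y)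

theorem mdifferentiableAt_applyJ (hX : MDiffAt (T% X) x) : MDiffAt (T% (S.applyJ X)) x := 
  MDifferentiableAt.clm_bundle_apply (F₁ := E) (F₂ := E) (S.contMDiff_J.mdifferentiable (by simp) x) hX

theorem applyJ_add : S.applyJ (X + X') = S.applyJ X + S.applyJ X' := by funext y; simp [applyJ]
theorem applyJ_smul : S.applyJ (f • X) = f • S.applyJ X := by funext y; simp [applyJ]
theorem applyJ_applyJ : S.applyJ (S.applyJ X) = -X := by funext y; simp [applyJ, S.J_sq]
@[simp] theorem applyJ_apply : S.applyJ X x = S.J x (X x) := rfl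

theorem inner_J_left (v w : TangentSpace 𝓘(ℝ, E) x) : inner ℝ (S.J x v) w = - inner ℝ v (S.J x w) := by
  rw [← S.inner_J, S.J_sq, inner_neg_left]

open VectorField in
/-- The real vector field corresponding to `∇_{X^{0,1}} Y^{1,0} = [X^{0,1}, Y^{1,0}]^{1,0}`. -/
noncomputable def mixedPart (X Y : ∀ y : M, TangentSpace 𝓘(ℝ, E) y) (x : M) : TangentSpace 𝓘(ℝ, E) x :=
  (1/4 : ℝ) • (mlieBracket 𝓘(ℝ, E) X Y x + mlieBracket 𝓘(ℝ, E) (S.applyJ X) (S.applyJ Y) x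
    + S.J x (mlieBracket 𝓘(ℝ, E) (S.applyJ X) Y x) - S.J x (mlieBracket 𝓘(ℝ, E) X (S.applyJ Y) x))

theorem mixedPart_add_left (hX : MDiffAt (T% X) x) (hX' : MDiffAt (T% X') x) :
    S.mixedPart (X + X') Y x = S.mixedPart X Y x + S.mixedPart X' Y x := by
  have := FiniteDimensional.complete ℝ E
  simp only [mixedPart, applyJ_add, VectorField.mlieBracket_add_left hX hX', VectorField.mlieBracket_add_left (S.mdifferentiableAt_applyJ hX) (S.mdifferentiableAt_applyJ hX'), map_add]
  module

theorem mixedPart_add_right (hX : MDiffAt (T% X) x) (hX' : MDiffAt (T% X') x) :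
    S.mixedPart Y (X + X') x = S.mixedPart Y X x + S.mixedPart Y X' x := by
  have := FiniteDimensional.complete ℝ E
  simp only [mixedPart, applyJ_add, VectorField.mlieBracket_add_right hX hX', VectorField.mlieBracket_add_right (S.mdifferentiableAt_applyJ hX) (S.mdifferentiableAt_applyJ hX'), map_add]
  module

theorem mixedPart_smul_left (hf : MDiffAt f x) (hX : MDiffAt (T% X) x) :
    S.mixedPart (f • X) Y x = f x • S.mixedPart X Y x := by
  have := FiniteDimensional.complete ℝ E
  simp only [mixedPart, applyJ_smul, VectorField.mlieBracket_smul_left hf hX, VectorField.mlieBracket_smul_left hf (S.mdifferentiableAt_applyJ hX), map_add, map_smul, applyJ_apply, S.J_sq]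
  module

theorem mixedPart_smul_right (hf : MDiffAt f x) (hX : MDiffAt (T% X) x) :
    S.mixedPart Y (f • X) x = f x • S.mixedPart Y X x + (1/2 : ℝ) • (mvfderiv 𝓘(ℝ, E) f x (Y x) • X x + mvfderiv 𝓘(ℝ, E) f x (S.J x (Y x)) • S.J x (X x)) := by
  have := FiniteDimensional.complete ℝ E
  simp only [mixedPart, applyJ_smul, VectorField.mlieBracket_smul_right hf hX, VectorField.mlieBracket_smul_right hf (S.mdifferentiableAt_applyJ hX), map_add, map_smul, applyJ_apply, S.J_sq]
  module


theorem bracket_neg_left (hX : MDiffAt (T% X) x) : VectorField.mlieBracket 𝓘(ℝ, E) (-X) Y x = - VectorField.mlieBracket 𝓘(ℝ, E) X Y x := by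
  have := FiniteDimensional.complete ℝ E
  have h := VectorField.mlieBracket_const_smul_left (I := 𝓘(ℝ, E)) (c := (-1 : ℝ)) (W := Y) hX
  simpa using h

theorem bracket_neg_right (hX : MDiffAt (T% X) x) : VectorField.mlieBracket 𝓘(ℝ, E) Y (-X) x = - VectorField.mlieBracket 𝓘(ℝ, E) Y X x := by
  have := FiniteDimensional.complete ℝ E
  have h := VectorField.mlieBracket_const_smul_right (I := 𝓘(ℝ, E)) (c := (-1 : ℝ)) (V := Y) hX
  simpa using h

theorem mixedPart_J_right (hY : MDiffAt (T% Y) x) : S.mixedPart X (S.applyJ Y) x = S.J x (S.mixedPart X Y x) := by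
  simp only [mixedPart, applyJ_applyJ, map_add, map_sub, map_smul, S.J_sq, bracket_neg_right hY, map_neg]
  module

theorem mixedPart_J_left (hX : MDiffAt (T% X) x) : S.mixedPart (S.applyJ X) Y x = - S.J x (S.mixedPart X Y x) := by
  simp only [mixedPart, applyJ_applyJ, map_add, map_sub, map_smul, S.J_sq, bracket_neg_left hX, map_neg]
  module

/-- The function `g(Y, Z)`. -/
noncomputable def ip (Y Z : ∀ y : M, TangentSpace 𝓘(ℝ, E) y) (y : M) : ℝ := inner ℝ (Y y) (Z y)

/-- The formula for `g(∇_X Y, Z)`. -/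
noncomputable def koszul (X Y Z : ∀ y : M, TangentSpace 𝓘(ℝ, E) y) (x : M) : ℝ :=
  (1/2) * (mvfderiv 𝓘(ℝ, E) (ip Y Z) x (X x)
    + mvfderiv 𝓘(ℝ, E) (ip Y (S.applyJ Z)) x (S.J x (X x)))
  + inner ℝ (S.mixedPart X Y x) (Z x) - inner ℝ (Y x) (S.mixedPart X Z x)

theorem ip_comm (Y Z : ∀ y : M, TangentSpace 𝓘(ℝ, E) y) : ip Y Z = ip Z Y := by
  funext y; exact real_inner_comm _ _

theorem mdiff_inner (hY : MDiffAt (T% Y) x) (hZ : MDiffAt (T% Z) x) :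
    MDiffAt (ip Y Z) x :=
  MDifferentiableAt.inner_bundle (F := E) hY hZ

theorem d_inner_smul_right (hf : MDiffAt f x) (hY : MDiffAt (T% Y) x) (hZ : MDiffAt (T% Z) x)
    (v : TangentSpace 𝓘(ℝ, E) x) :
    mvfderiv 𝓘(ℝ, E) (ip Y (f • Z)) x v =
      f x * mvfderiv 𝓘(ℝ, E) (ip Y Z) x v
        + mvfderiv 𝓘(ℝ, E) f x v * inner ℝ (Y x) (Z x) := by
  have h : (ip Y (f • Z)) = f * ip Y Z := by
    funext y; simp [ip, inner_smul_right]
  rw [h, mvfderiv_mul hf (mdiff_inner hY hZ)]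
  simp [ip]
  ring

theorem d_inner_smul_left (hf : MDiffAt f x) (hY : MDiffAt (T% Y) x) (hZ : MDiffAt (T% Z) x)
    (v : TangentSpace 𝓘(ℝ, E) x) :
    mvfderiv 𝓘(ℝ, E) (ip (f • Y) Z) x v =
      f x * mvfderiv 𝓘(ℝ, E) (ip Y Z) x v
        + mvfderiv 𝓘(ℝ, E) f x v * inner ℝ (Y x) (Z x) := by
  rw [ip_comm, d_inner_smul_right hf hZ hY, ip_comm, real_inner_comm]

theorem d_inner_add_right (hY : MDiffAt (T% Y) x) (hX : MDiffAt (T% X) x) (hX' : MDiffAt (T% X') x)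
    (v : TangentSpace 𝓘(ℝ, E) x) :
    mvfderiv 𝓘(ℝ, E) (ip Y (X + X')) x v =
      mvfderiv 𝓘(ℝ, E) (ip Y X) x v
        + mvfderiv 𝓘(ℝ, E) (ip Y X') x v := by
  have h : (ip Y (X + X')) =
      (ip Y X) + ip Y X' := by
    funext y; simp [ip, inner_add_right]
  rw [h, mvfderiv_add (mdiff_inner hY hX) (mdiff_inner hY hX')]
  simp

theorem d_inner_add_left (hY : MDiffAt (T% Y) x) (hX : MDiffAt (T% X) x) (hX' : MDiffAt (T% X') x)
    (v : TangentSpace 𝓘(ℝ, E) x) :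
    mvfderiv 𝓘(ℝ, E) (ip (X + X') Y) x v =
      mvfderiv 𝓘(ℝ, E) (ip X Y) x v
        + mvfderiv 𝓘(ℝ, E) (ip X' Y) x v := by
  rw [ip_comm, d_inner_add_right hY hX hX', ip_comm Y X, ip_comm Y X']

theorem koszul_tensorial_left (Y Z : ∀ y : M, TangentSpace 𝓘(ℝ, E) y) :
    TensorialAt 𝓘(ℝ, E) E (fun X ↦ S.koszul X Y Z x) x where
  smul hf hX := by
    simp only [koszul, S.mixedPart_smul_left hf hX, Pi.smul_apply', map_smul, inner_smul_left, inner_smul_right, smul_eq_mul, conj_trivial]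
    ring
  add hX hX' := by
    simp only [koszul, S.mixedPart_add_left hX hX', Pi.add_apply, map_add, inner_add_left, inner_add_right]
    ring

theorem koszul_tensorial_right (hY : MDiffAt (T% Y) x) (X : ∀ y : M, TangentSpace 𝓘(ℝ, E) y) :
    TensorialAt 𝓘(ℝ, E) E (fun Z ↦ S.koszul X Y Z x) x where
  smul hf hZ := by
    simp only [koszul, S.mixedPart_smul_right hf hZ, applyJ_smul, d_inner_smul_right hf hY hZ, d_inner_smul_right hf hY (S.mdifferentiableAt_applyJ hZ), Pi.smul_apply', inner_add_right, inner_smul_right, smul_eq_mul, applyJ_apply]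
    ring
  add hX hX' := by
    simp only [koszul, S.mixedPart_add_right hX hX', applyJ_add, d_inner_add_right hY hX hX', d_inner_add_right hY (S.mdifferentiableAt_applyJ hX) (S.mdifferentiableAt_applyJ hX'), Pi.add_apply, inner_add_right]
    ring

theorem koszul_add (hX : MDiffAt (T% X) x) (hX' : MDiffAt (T% X') x) (hZ : MDiffAt (T% Z) x) :
    S.koszul Y (X + X') Z x = S.koszul Y X Z x + S.koszul Y X' Z x := by
  simp only [koszul, S.mixedPart_add_right hX hX', d_inner_add_left hZ hX hX', d_inner_add_left (S.mdifferentiableAt_applyJ hZ) hX hX', Pi.add_apply, inner_add_left]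
  ring

theorem koszul_smul (hf : MDiffAt f x) (hX : MDiffAt (T% X) x) (hZ : MDiffAt (T% Z) x) :
    S.koszul Y (f • X) Z x = f x * S.koszul Y X Z x + mvfderiv 𝓘(ℝ, E) f x (Y x) * inner ℝ (X x) (Z x) := by
  simp only [koszul, S.mixedPart_smul_right hf hX, d_inner_smul_left hf hX hZ, d_inner_smul_left hf hX (S.mdifferentiableAt_applyJ hZ), Pi.smul_apply', inner_add_left, inner_smul_left, conj_trivial, applyJ_apply, inner_J_left]
  ring

theorem koszul_metric : S.koszul X Y Z x + S.koszul X Z Y x = mvfderiv 𝓘(ℝ, E) (ip Y Z) x (X x) := by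
  have h : (ip Z (S.applyJ Y)) = - ip Y (S.applyJ Z) := by
    funext y
    simp [ip, ← S.inner_J_left, real_inner_comm]
  have h' : (ip Z Y) = ip Y Z := by
    funext y; exact real_inner_comm _ _
  simp only [koszul, h, h', mvfderiv_neg, real_inner_comm (Y x), real_inner_comm (Z x)]
  simp
  ring

theorem koszul_J (hY : MDiffAt (T% Y) x) (hZ : MDiffAt (T% Z) x) : S.koszul X (S.applyJ Y) Z x = - S.koszul X Y (S.applyJ Z) x := by
  have h1 : (ip (S.applyJ Y) Z) = - ip Y (S.applyJ Z) := by
    funext y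
    simp [ip, S.inner_J_left]
  have h2 : (ip (S.applyJ Y) (S.applyJ Z)) = ip Y Z := by
    funext y; simp [ip, S.inner_J]
  have h3 : (ip Y (S.applyJ (S.applyJ Z))) = - ip Y Z := by
    funext y; simp [ip, S.J_sq]
  simp only [koszul, h1, h2, h3, mvfderiv_neg, S.mixedPart_J_right hY, S.mixedPart_J_right hZ, applyJ_apply, S.inner_J_left]
  simp
  ring

theorem koszul_torsion (hX : MDiffAt (T% X) x) (hZ : MDiffAt (T% Z) x) (hY : MDiffAt (T% Y) x) :
    S.koszul X Y Z x + S.koszul (S.applyJ X) (S.applyJ Y) Z x = 2 * inner ℝ (S.mixedPart X Y x) (Z x) := by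
  rw [S.koszul_J hY hZ]
  have h3 : (ip Y (S.applyJ (S.applyJ Z))) = - ip Y Z := by
    funext y; simp [ip, S.J_sq]
  simp only [koszul, h3, mvfderiv_neg, S.mixedPart_J_right hZ, S.mixedPart_J_left hX, applyJ_apply, map_neg, S.J_sq, inner_neg_left, S.inner_J]
  simp
  ring

theorem exists_hom (Y : ∀ y : M, TangentSpace 𝓘(ℝ, E) y) (x : M) :
    ∃ A : TangentSpace 𝓘(ℝ, E) x →L[ℝ] TangentSpace 𝓘(ℝ, E) x, MDiffAt (T% Y) x →
      ∀ X Z : ∀ y : M, TangentSpace 𝓘(ℝ, E) y, MDiffAt (T% X) x → MDiffAt (T% Z) x →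
        inner ℝ (A (X x)) (Z x) = S.koszul X Y Z x := by
  by_cases hY : MDiffAt (T% Y) x
  swap
  · exact ⟨0, fun h ↦ (hY h).elim⟩
  have h1 := fun Z (_ : MDiffAt (T% Z) x) ↦ S.koszul_tensorial_left (x := x) Y Z
  have h2 := fun X (_ : MDiffAt (T% X) x) ↦ S.koszul_tensorial_right hY X
  let B : TangentSpace 𝓘(ℝ, E) x →L[ℝ] TangentSpace 𝓘(ℝ, E) x →L[ℝ] ℝ :=
    TensorialAt.mkHom₂ (I := 𝓘(ℝ, E)) (F := E) (F' := E) (fun X Z ↦ S.koszul X Y Z x) x h1 h2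
  have : FiniteDimensional ℝ (TangentSpace 𝓘(ℝ, E) x) := VectorBundle.finiteDimensional ℝ E (fun x : M ↦ TangentSpace 𝓘(ℝ, E) x) x
  let b := stdOrthonormalBasis ℝ (TangentSpace 𝓘(ℝ, E) x)
  refine ⟨∑ i, (B.flip (b i)).smulRight (b i), fun _ X Z hX hZ ↦ ?_⟩
  have hB : B (X x) (Z x) = S.koszul X Y Z x := TensorialAt.mkHom₂_apply h1 h2 hX hZ
  rw [← hB]
  conv_rhs => rw [← b.sum_repr' (Z x)]
  simp [sum_inner, inner_smul_left, mul_comm]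

theorem exists_isCanonicalConnection : ∃ D, S.IsCanonicalConnection D := by
  have hc := FiniteDimensional.complete ℝ E
  choose A hA using S.exists_hom
  have key : ∀ (x : M) (v w : TangentSpace 𝓘(ℝ, E) x), (∀ Z : ∀ y : M, TangentSpace 𝓘(ℝ, E) y, MDiffAt (T% Z) x → (inner ℝ v (Z x) : ℝ) = inner ℝ w (Z x)) → v = w := by
    intro x v w h
    refine ext_inner_right ℝ fun z ↦ ?_
    simpa using h (FiberBundle.extend E z) (FiberBundle.mdifferentiableAt_extend 𝓘(ℝ, E) E z)
  have ext : ∀ (x : M) (v : TangentSpace 𝓘(ℝ, E) x), ∃ X : ∀ y : M, TangentSpace 𝓘(ℝ, E) y, MDiffAt (T% X) x ∧ X x = v :=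
    fun x v ↦ ⟨FiberBundle.extend E v, FiberBundle.mdifferentiableAt_extend 𝓘(ℝ, E) E v, by simp⟩
  let D : CovariantDerivative 𝓘(ℝ, E) E (TangentSpace 𝓘(ℝ, E) : M → Type _) :=
    { toFun := A
      isCovariantDerivativeOnUniv :=
        { add := by
            intro Y Y' x hY hY' _
            ext v
            obtain ⟨X, hX, rfl⟩ := ext x v
            refine key x _ _ fun Z hZ ↦ ?_
            rw [hA _ _ (mdifferentiableAt_add_section hY hY') X Z hX hZ, S.koszul_add hY hY' hZ,
              add_apply, inner_add_left, hA _ _ hY X Z hX hZ, hA _ _ hY' X Z hX hZ]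
          leibniz := by
            intro Y f x hY hf _
            ext v
            obtain ⟨X, hX, rfl⟩ := ext x v
            refine key x _ _ fun Z hZ ↦ ?_
            rw [hA _ _ (hf.smul_section hY) X Z hX hZ, S.koszul_smul hf hY hZ]
            simp [inner_add_left, inner_smul_left, hA _ _ hY X Z hX hZ] } }
  have hD : ∀ (Y : ∀ y : M, TangentSpace 𝓘(ℝ, E) y) (x : M), MDiffAt (T% Y) x →
      ∀ X Z : ∀ y : M, TangentSpace 𝓘(ℝ, E) y, MDiffAt (T% X) x → MDiffAt (T% Z) x →
        inner ℝ (D Y x (X x)) (Z x) = S.koszul X Y Z x := hA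
  refine ⟨D, ?_, ?_, ?_⟩
  · intro x Y Z hY hZ v
    obtain ⟨X, hX, rfl⟩ := ext x v
    change mvfderiv 𝓘(ℝ, E) (ip Y Z) x (X x) = _
    rw [real_inner_comm _ (Y x), hD Y x hY X Z hX hZ, hD Z x hZ X Y hX hY, S.koszul_metric]
  · intro x Y hY v
    obtain ⟨X, hX, rfl⟩ := ext x v
    refine key x _ _ fun Z hZ ↦ ?_
    have h := hD _ x (S.mdifferentiableAt_applyJ hY) X Z hX hZ
    rw [S.koszul_J hY hZ, ← hD Y x hY X _ hX (S.mdifferentiableAt_applyJ hZ)] at h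
    rw [S.inner_J_left]
    exact h
  · have main : ∀ (x : M) (v w : TangentSpace 𝓘(ℝ, E) x), D.torsion x v w + D.torsion x (S.J x v) (S.J x w) = 0 := by
      intro x v w
      obtain ⟨X, hX, rfl⟩ := ext x v
      obtain ⟨Y, hY, rfl⟩ := ext x w
      refine key x _ _ fun Z hZ ↦ ?_
      have e1 := D.torsion_apply hX hY
      have e2 := D.torsion_apply (S.mdifferentiableAt_applyJ hX) (S.mdifferentiableAt_applyJ hY)
      have hx := S.koszul_torsion hX hZ hY
      have hy := S.koszul_torsion hY hZ hX
      rw [← hD Y x hY X Z hX hZ, ← hD _ x (S.mdifferentiableAt_applyJ hY) _ Z (S.mdifferentiableAt_applyJ hX) hZ] at hx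
      rw [← hD X x hX Y Z hY hZ, ← hD _ x (S.mdifferentiableAt_applyJ hX) _ Z (S.mdifferentiableAt_applyJ hY) hZ] at hy
      have hP : (2 : ℝ) • S.mixedPart X Y x - (2 : ℝ) • S.mixedPart Y X x = VectorField.mlieBracket 𝓘(ℝ, E) X Y x + VectorField.mlieBracket 𝓘(ℝ, E) (S.applyJ X) (S.applyJ Y) x := by
        simp only [mixedPart]
        rw [VectorField.mlieBracket_swap_apply (V := Y) (W := X), VectorField.mlieBracket_swap_apply (V := S.applyJ Y) (W := S.applyJ X), VectorField.mlieBracket_swap_apply (V := S.applyJ Y) (W := X),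
          VectorField.mlieBracket_swap_apply (V := Y) (W := S.applyJ X)]
        simp only [map_neg]
        module
      simp only [applyJ_apply] at e1 e2 hx hy
      rw [e1, e2]
      have hP' := congrArg (fun u ↦ (inner ℝ u (Z x) : ℝ)) hP
      simp only [inner_sub_left, inner_add_left, inner_smul_left, conj_trivial] at hP' ⊢
      simp only [inner_zero_left]
      linarith
    intro x v w
    refine ⟨main x v w, ?_⟩
    have h := main x v (S.J x w)
    simpa [S.J_sq, sub_eq_add_neg] using h

/-- Two canonical connections agree on every vector field differentiable at `x`. -/
theorem IsCanonicalConnection.unique {D D' : CovariantDerivative 𝓘(ℝ, E) E (TangentSpace 𝓘(ℝ, E) : M → Type _)}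
    (h : S.IsCanonicalConnection D) (h' : S.IsCanonicalConnection D') (hY : MDiffAt (T% Y) x) : D Y x = D' Y x := by
  have hc := FiniteDimensional.complete ℝ E
  have ext : ∀ v : TangentSpace 𝓘(ℝ, E) x, ∃ X : ∀ y : M, TangentSpace 𝓘(ℝ, E) y, MDiffAt (T% X) x ∧ X x = v :=
    fun v ↦ ⟨FiberBundle.extend E v, FiberBundle.mdifferentiableAt_extend 𝓘(ℝ, E) E v, by simp⟩
  have hJ : ∀ v w : TangentSpace 𝓘(ℝ, E) x, (inner ℝ (S.J x v) w : ℝ) = - inner ℝ v (S.J x w) := fun v w ↦ S.inner_J_left v w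
  -- the difference `X, Y ↦ D_X Y - D'_X Y`
  have a_J : ∀ Y : ∀ y : M, TangentSpace 𝓘(ℝ, E) y, MDiffAt (T% Y) x → ∀ v,
      D (S.applyJ Y) x v - D' (S.applyJ Y) x v = S.J x (D Y x v - D' Y x v) := fun Y hY v ↦ by
    rw [map_sub, ← h.parallel x Y hY v, ← h'.parallel x Y hY v]; rfl
  have a_skew : ∀ Y Z : ∀ y : M, TangentSpace 𝓘(ℝ, E) y, MDiffAt (T% Y) x → MDiffAt (T% Z) x → ∀ v,
      (inner ℝ (D Y x v - D' Y x v) (Z x) : ℝ) = - inner ℝ (Y x) (D Z x v - D' Z x v) := fun Y Z hY hZ v ↦ by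
    have e := (h.metric x Y Z hY hZ v).symm.trans (h'.metric x Y Z hY hZ v)
    rw [inner_sub_left, inner_sub_right]; linarith
  have a_tor : ∀ X Y : ∀ y : M, TangentSpace 𝓘(ℝ, E) y, MDiffAt (T% X) x → MDiffAt (T% Y) x →
      (D Y x (X x) - D' Y x (X x)) + S.J x (D Y x (S.J x (X x)) - D' Y x (S.J x (X x))) =
      (D X x (Y x) - D' X x (Y x)) + S.J x (D X x (S.J x (Y x)) - D' X x (S.J x (Y x))) := fun X Y hX hY ↦ by
    have e := (h.torsion x (X x) (Y x)).1
    have e' := (h'.torsion x (X x) (Y x)).1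
    rw [← S.applyJ_apply, ← S.applyJ_apply, CovariantDerivative.torsion_apply _ hX hY, CovariantDerivative.torsion_apply _ (S.mdifferentiableAt_applyJ hX) (S.mdifferentiableAt_applyJ hY)] at e e'
    rw [← a_J Y hY, ← a_J X hX]
    simp only [applyJ_apply] at e e' ⊢
    have e2 := e.trans e'.symm
    rw [← sub_eq_zero] at e2 ⊢
    rw [← e2]
    abel
  have a_lin : ∀ X Y : ∀ y : M, TangentSpace 𝓘(ℝ, E) y, MDiffAt (T% X) x → MDiffAt (T% Y) x →
      D Y x (S.J x (X x)) - D' Y x (S.J x (X x)) = S.J x (D Y x (X x) - D' Y x (X x)) := fun X Y hX hY ↦ by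
    have e1 := a_tor X Y hX hY
    have e2 := a_tor (S.applyJ X) Y (S.mdifferentiableAt_applyJ hX) hY
    rw [a_J X hX, a_J X hX] at e2
    simp only [applyJ_apply, S.J_sq, map_neg] at e2
    have e3 := congrArg (S.J x) e1
    simp only [map_add, map_sub, S.J_sq] at e2 e3 ⊢
    have e4 : (2 : ℝ) • (D Y x (S.J x (X x)) - D' Y x (S.J x (X x))) = (2 : ℝ) • (S.J x (D Y x (X x)) - S.J x (D' Y x (X x))) := by
      rw [← sub_eq_zero] at e2 e3 ⊢
      have e5 := congrArg₂ (fun a b ↦ a - b) e2 e3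
      simp only [sub_zero, map_neg] at e5
      rw [← e5]
      module
    exact smul_right_injective _ (two_ne_zero) e4
  ext v
  rw [← sub_eq_zero]
  refine ext_inner_right ℝ fun z ↦ ?_
  obtain ⟨Z, hZ, rfl⟩ := ext z
  obtain ⟨X, hX, hv⟩ := ext (- S.J x v)
  have hv' : S.J x (X x) = v := by rw [hv, map_neg, S.J_sq, neg_neg]
  have e1 := a_lin X Y hX hY
  have e2 := a_lin X Z hX hZ
  have e3 := a_skew Y Z hY hZ v
  have e4 := a_skew Y (S.applyJ Z) hY (S.mdifferentiableAt_applyJ hZ) (X x)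
  rw [a_J Z hZ, ← e2, hv', applyJ_apply] at e4
  rw [hv'] at e1
  have e5 : (inner ℝ (D Y x v - D' Y x v) (Z x) : ℝ) = - inner ℝ (D Y x (X x) - D' Y x (X x)) (S.J x (Z x)) := by
    rw [e1, hJ]
  rw [inner_zero_left]
  linarith
/-- The canonical connection of an almost Hermitian manifold. -/
noncomputable def canonicalConnection :
    CovariantDerivative 𝓘(ℝ, E) E (TangentSpace 𝓘(ℝ, E) : M → Type _) :=
  S.exists_isCanonicalConnection.choose

theorem isCanonicalConnection_canonicalConnection :
    S.IsCanonicalConnection S.canonicalConnection :=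
  S.exists_isCanonicalConnection.choose_spec

/-! ### Curvature, Hessian, tamed exhaustion functions -/

/-- `R(X,Y)Z = ∇_X ∇_Y Z - ∇_Y ∇_X Z - ∇_[X,Y] Z` for vector fields, with `∇` the canonical
connection. -/
noncomputable def curvatureField (X Y Z : ∀ y : M, TangentSpace 𝓘(ℝ, E) y) (x : M) :
    TangentSpace 𝓘(ℝ, E) x :=
  S.canonicalConnection (fun y ↦ S.canonicalConnection Z y (Y y)) x (X x)
    - S.canonicalConnection (fun y ↦ S.canonicalConnection Z y (X y)) x (Y x)
    - S.canonicalConnection Z x (VectorField.mlieBracket 𝓘(ℝ, E) X Y x)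

/-- The curvature tensor `R(u,v)w` at a point, computed with extensions of `u`, `v`, `w` to vector
fields that are smooth near the point. -/
noncomputable def curvature (x : M) (u v w : TangentSpace 𝓘(ℝ, E) x) : TangentSpace 𝓘(ℝ, E) x :=
  S.curvatureField (FiberBundle.extend E u) (FiberBundle.extend E v) (FiberBundle.extend E w) x

/-- The holomorphic sectional curvature `g(R(v,Jv)Jv, v) / |v|⁴` in the direction of `v ≠ 0`.
For the `(1,0)` vector `Z = v - iJv`, complex multilinearity gives `R(Z, Z̄) = 2i R(v, Jv)`, and
since `R(v, Jv)` is skew and commutes with `J`, the number equals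
`g(R(Z, Z̄)Z, Z̄) / g(Z, Z̄)²`. -/
noncomputable def holSecCurvature (x : M) (v : TangentSpace 𝓘(ℝ, E) x) : ℝ :=
  inner ℝ (S.curvature x v (S.J x v) (S.J x v)) v / ‖v‖ ^ 4

/-- The Hessian `(∇du)(X,Y) = Y(Xu) - (∇_Y X)u` for the canonical connection, at a point near
which `u` is `C²`. -/
noncomputable def hessian (u : M → ℝ) (x : M) (v w : TangentSpace 𝓘(ℝ, E) x) : ℝ :=
  mvfderiv 𝓘(ℝ, E) (fun y ↦ mvfderiv 𝓘(ℝ, E) u y (FiberBundle.extend E v y)) x w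
    - mvfderiv 𝓘(ℝ, E) u x (S.canonicalConnection (FiberBundle.extend E v) x w)

/-- The value `(∇du)(Z, Z̄)` of the complexified Hessian on the `(1,0)` vector `Z = v - iJv`. Its
imaginary part `(∇du)(v, Jv) - (∇du)(Jv, v) = du(τ(v, Jv))` vanishes. -/
noncomputable def leviForm (u : M → ℝ) (x : M) (v : TangentSpace 𝓘(ℝ, E) x) : ℝ :=
  S.hessian u x v v + S.hessian u x (S.J x v) (S.J x v)

/-- Tamed exhaustion functions. The bound `|dv(X)| ≤ C |X|` for all `X` says `‖∇v‖(p) ≤ C`, as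
`dv(X) = g(∇v, X)`. Since `g(Z, Z̄) = 2|X|²` for `Z = X - iJX`, the last condition is the inequality
`(v_{k l̄}(p)) ≤ C (g_{k l̄}(p))` of Hermitian forms. -/
structure IsTamedExhaustion (u : M → ℝ) : Prop where
  continuous : Continuous u
  nonneg : ∀ x, 0 ≤ u x
  proper : ∀ c : ℝ, IsCompact (u ⁻¹' Set.Iic c)
  tamed : ∃ C : ℝ, 0 < C ∧ ∀ p : M, ∃ (V : Set M) (v : M → ℝ), IsOpen V ∧ p ∈ V ∧
    ContMDiffOn 𝓘(ℝ, E) 𝓘(ℝ, ℝ) 2 v V ∧ (∀ x ∈ V, u x ≤ v x) ∧ v p = u p ∧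
    (∀ X : TangentSpace 𝓘(ℝ, E) p, |mvfderiv 𝓘(ℝ, E) v p X| ≤ C * ‖X‖) ∧
    ∀ X : TangentSpace 𝓘(ℝ, E) p, S.leviForm v p X ≤ C * (2 * ‖X‖ ^ 2)

end AlmostHermitianStructure

variable {F : Type*} [NormedAddCommGroup F] [NormedSpace ℝ F]
  {N : Type*} [TopologicalSpace N] [ChartedSpace F N] [IsManifold 𝓘(ℝ, F) ∞ N]
  [RiemannianBundle (fun y : N ↦ TangentSpace 𝓘(ℝ, F) y)]

/-- A smooth map `f` is almost holomorphic if `df ∘ J = J̃ ∘ df`. -/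
structure IsAlmostHolomorphic (S : AlmostHermitianStructure E M)
    (S' : AlmostHermitianStructure F N) (f : M → N) : Prop where
  contMDiff : ContMDiff 𝓘(ℝ, E) 𝓘(ℝ, F) ∞ f
  mfderiv_J : ∀ (x : M) (v : TangentSpace 𝓘(ℝ, E) x),
    mfderiv 𝓘(ℝ, E) 𝓘(ℝ, F) f x (S.J x v) = S'.J (f x) (mfderiv 𝓘(ℝ, E) 𝓘(ℝ, F) f x v)

end AlmostHermitian

/-! The proof is a Schwarz lemma in the style of Yau, with second derivatives taken only along one
complex direction. Let `energy` be the largest value of `|df v|²` over unit vectors `v`. For small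
`r > 0` the function `(1 - r u)² · energy` attains its maximum over the compact set `{u ≤ 1/r}` at
some `p`. Near `p` the continuous function `u` is replaced by the `C²` function `v ≥ u` touching it
at `p`, so `p` remains a local maximum. With `η = (1 - r v)²`, `X` a unit vector at `p` realizing `Λ
= energy p`, and `X` extended so that `∇X = 0` at `p`, the function `η |df X|² - η(p) Λ |X|²` has a
local maximum at `p`. Hence the sum of its second derivatives along `X` and `JX` is at most zero
there.

That sum is computed by a Bochner formula (`lap_energy`). Its source is `second_fderiv`: because the
torsions have no `(1,1)`-part, the `(0,1)`-part of the second fundamental form of an almost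
holomorphic map vanishes. So the `(0,1)`-derivative of `df X` is the image under `df` of the
`(0,1)`-derivative of `X`, and commuting covariant derivatives leaves a curvature term, squares of
first derivatives, and one term `df (dDbar X)` that no hypothesis controls. The identity map gives
the same formula for `|X|²`, with `dDbar X` again. Since `X` maximizes `|df ·|²` on unit vectors, it
lies in the radical of the nonnegative form `Λ g - f^* g̃`; hence the two uncontrolled terms cancel.

What remains (`max_estimate`), with the bounds on `dv` and on the Levi form of `v`, reads `k₂ η(p) Λ
≤ k₁ + O(r)`; letting `r` tend to `0` gives `k₂ · energy ≤ k₁` at every point (`mul_energy_le`). If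
`k₁ = 0` then `df = 0` and `f` is locally constant.

The computation takes place in open subsets of vector spaces. To transfer it, the canonical
connection, which is only known to exist, must have smooth Christoffel symbols; a Koszul formula
supplies this (`koszul_formula`, `contDiffOn_Γ_of_koszul`). -/

/-- A metric, an almost complex structure and Christoffel symbols on (a subset of) a vector
space. -/
structure LocalHermitianData (E : Type*) [NormedAddCommGroup E] [NormedSpace ℝ E] where
  /-- the metric -/
  G : E → E →L[ℝ] E →L[ℝ] ℝ
  /-- the almost complex structure -/
  J : E → E →L[ℝ] E
  /-- the Christoffel symbols: `∇_a b = Γ a b` for constant fields `a`, `b` -/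
  Γ : E → E →L[ℝ] E →L[ℝ] E

/-! ### Connections along maps and the second fundamental form, in coordinates -/

namespace LocalHermitianData

section Flat

set_option maxSynthPendingDepth 3

variable {E : Type*} [NormedAddCommGroup E] [NormedSpace ℝ E]
  {F : Type*} [NormedAddCommGroup F] [NormedSpace ℝ F]

/-- On the open set `U` the data describe an almost Hermitian structure with its canonical
connection. -/
structure IsHermitianOn (c : LocalHermitianData E) (U : Set E) : Prop where
  isOpen : IsOpen U
  contDiffOn_G : ContDiffOn ℝ ∞ c.G U
  contDiffOn_J : ContDiffOn ℝ ∞ c.J U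
  contDiffOn_Γ : ContDiffOn ℝ ∞ c.Γ U
  symm : ∀ z ∈ U, ∀ a b, c.G z a b = c.G z b a
  nonneg : ∀ z ∈ U, ∀ a, 0 ≤ c.G z a a
  J_sq : ∀ z ∈ U, ∀ a, c.J z (c.J z a) = -a
  G_J : ∀ z ∈ U, ∀ a b, c.G z (c.J z a) (c.J z b) = c.G z a b
  metric : ∀ z ∈ U, ∀ v a b, fderiv ℝ c.G z v a b = c.G z (c.Γ z v a) b + c.G z a (c.Γ z v b)
  parallel : ∀ z ∈ U, ∀ v a, fderiv ℝ c.J z v a + c.Γ z v (c.J z a) = c.J z (c.Γ z v a)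
  torsion_add : ∀ z ∈ U, ∀ a b, c.Γ z a b - c.Γ z b a
    + (c.Γ z (c.J z a) (c.J z b) - c.Γ z (c.J z b) (c.J z a)) = 0

/-- The curvature tensor of the connection with Christoffel symbols `Γ`. -/
noncomputable def curv (c : LocalHermitianData E) (z : E) (a b d : E) : E :=
  fderiv ℝ c.Γ z a b d - fderiv ℝ c.Γ z b a d + c.Γ z a (c.Γ z b d) - c.Γ z b (c.Γ z a d)

/-- The pulled back connection on vector fields `s` along `f`. -/
noncomputable def covAlong (c : LocalHermitianData F) (f s : E → F) (z v : E) : F :=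
  fderiv ℝ s z v + c.Γ (f z) (fderiv ℝ f z v) (s z)

variable {c : LocalHermitianData F} {U : Set F} {f s t : E → F} {z v : E}

theorem IsHermitianOn.hasFDerivAt_G (h : c.IsHermitianOn U) {z : F} (hz : z ∈ U) :
    HasFDerivAt c.G (fderiv ℝ c.G z) z :=
  ((h.contDiffOn_G.contDiffAt (h.isOpen.mem_nhds hz)).differentiableAt (by simp)).hasFDerivAt

theorem IsHermitianOn.hasFDerivAt_J (h : c.IsHermitianOn U) {z : F} (hz : z ∈ U) :
    HasFDerivAt c.J (fderiv ℝ c.J z) z :=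
  ((h.contDiffOn_J.contDiffAt (h.isOpen.mem_nhds hz)).differentiableAt (by simp)).hasFDerivAt

theorem IsHermitianOn.hasFDerivAt_Γ (h : c.IsHermitianOn U) {z : F} (hz : z ∈ U) :
    HasFDerivAt c.Γ (fderiv ℝ c.Γ z) z :=
  ((h.contDiffOn_Γ.contDiffAt (h.isOpen.mem_nhds hz)).differentiableAt (by simp)).hasFDerivAt

theorem IsHermitianOn.fderiv_G_along (h : c.IsHermitianOn U) (hz : f z ∈ U)
    (hf : DifferentiableAt ℝ f z) (hs : DifferentiableAt ℝ s z) (ht : DifferentiableAt ℝ t z) :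
    fderiv ℝ (fun y ↦ c.G (f y) (s y) (t y)) z v =
      c.G (f z) (c.covAlong f s z v) (t z) + c.G (f z) (s z) (c.covAlong f t z v) := by
  have hG := HasFDerivAt.comp (g := c.G) (G := F →L[ℝ] F →L[ℝ] ℝ) z (h.hasFDerivAt_G hz)
    hf.hasFDerivAt
  have := ((hG.clm_apply hs.hasFDerivAt).clm_apply ht.hasFDerivAt).fderiv
  simp only [Function.comp_def] at this
  rw [this]
  simp [covAlong, h.metric _ hz]
  ring

theorem IsHermitianOn.covAlong_J (h : c.IsHermitianOn U) (hz : f z ∈ U)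
    (hf : DifferentiableAt ℝ f z) (hs : DifferentiableAt ℝ s z) :
    c.covAlong f (fun y ↦ c.J (f y) (s y)) z v = c.J (f z) (c.covAlong f s z v) := by
  have hJ := ((h.hasFDerivAt_J hz).comp z hf.hasFDerivAt)
  have := (hJ.clm_apply hs.hasFDerivAt).fderiv
  simp only [Function.comp_def] at this
  rw [covAlong, this]
  have := h.parallel _ hz (fderiv ℝ f z v) (s z)
  simp [covAlong, ← this]
  abel

theorem covAlong_add (hs : DifferentiableAt ℝ s z) (ht : DifferentiableAt ℝ t z) :
    c.covAlong f (fun y ↦ s y + t y) z v = c.covAlong f s z v + c.covAlong f t z v := by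
  simp [covAlong, fderiv_fun_add hs ht]
  abel

theorem covAlong_congr (hst : s =ᶠ[nhds z] t) : c.covAlong f s z v = c.covAlong f t z v := by
  simp [covAlong, hst.fderiv_eq, hst.eq_of_nhds]

theorem IsHermitianOn.fderiv_covAlong (h : c.IsHermitianOn U) (hz : f z ∈ U)
    (hf : ContDiffAt ℝ ∞ f z) (hs : ContDiffAt ℝ ∞ s z) {Y : E → E} (hY : DifferentiableAt ℝ Y z) :
    fderiv ℝ (fun y ↦ c.covAlong f s y (Y y)) z v =
      fderiv ℝ (fderiv ℝ s) z v (Y z) + fderiv ℝ s z (fderiv ℝ Y z v)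
      + (fderiv ℝ c.Γ (f z) (fderiv ℝ f z v) (fderiv ℝ f z (Y z)) (s z)
      + c.Γ (f z) (fderiv ℝ (fderiv ℝ f) z v (Y z) + fderiv ℝ f z (fderiv ℝ Y z v)) (s z)
      + c.Γ (f z) (fderiv ℝ f z (Y z)) (fderiv ℝ s z v)) := by
  have hdf : HasFDerivAt (fderiv ℝ f) (fderiv ℝ (fderiv ℝ f) z) z :=
    ((hf.fderiv_right (m := ∞) (by simp)).differentiableAt (by simp)).hasFDerivAt
  have hds : HasFDerivAt (fderiv ℝ s) (fderiv ℝ (fderiv ℝ s) z) z :=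
    ((hs.fderiv_right (m := ∞) (by simp)).differentiableAt (by simp)).hasFDerivAt
  have hf' := (hf.differentiableAt (by simp)).hasFDerivAt
  have hs' := (hs.differentiableAt (by simp)).hasFDerivAt
  have hΓ := HasFDerivAt.comp (g := c.Γ) (G := F →L[ℝ] F →L[ℝ] F) z (h.hasFDerivAt_Γ hz) hf'
  have := ((hds.clm_apply hY.hasFDerivAt).add
    ((hΓ.clm_apply (hdf.clm_apply hY.hasFDerivAt)).clm_apply hs')).fderiv
  simp only [Function.comp_def] at this
  unfold covAlong
  rw [show (fun y ↦ (fderiv ℝ s y) (Y y) + ((c.Γ (f y)) ((fderiv ℝ f y) (Y y))) (s y)) =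
    ((fun y ↦ (fderiv ℝ s y) (Y y)) + fun y ↦ ((c.Γ (f y)) ((fderiv ℝ f y) (Y y))) (s y)) from
      rfl, this]
  simp
  abel

/-- Second derivatives of `f` and `s` are symmetric, so only the curvature of the target and the
bracket `[X, Y]` survive. The torsion of the target does not enter. -/
theorem IsHermitianOn.covAlong_comm (h : c.IsHermitianOn U) (hz : f z ∈ U)
    (hf : ContDiffAt ℝ ∞ f z) (hs : ContDiffAt ℝ ∞ s z) {X Y : E → E}
    (hX : DifferentiableAt ℝ X z) (hY : DifferentiableAt ℝ Y z) :
    c.covAlong f (fun y ↦ c.covAlong f s y (Y y)) z (X z)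
      - c.covAlong f (fun y ↦ c.covAlong f s y (X y)) z (Y z) =
    c.curv (f z) (fderiv ℝ f z (X z)) (fderiv ℝ f z (Y z)) (s z)
      + c.covAlong f s z (fderiv ℝ Y z (X z) - fderiv ℝ X z (Y z)) := by
  have e1 : fderiv ℝ (fderiv ℝ f) z (X z) (Y z) = fderiv ℝ (fderiv ℝ f) z (Y z) (X z) :=
    (hf.isSymmSndFDerivAt (by simpa using ENat.LEInfty.out)).eq _ _
  have e2 : fderiv ℝ (fderiv ℝ s) z (X z) (Y z) = fderiv ℝ (fderiv ℝ s) z (Y z) (X z) :=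
    (hs.isSymmSndFDerivAt (by simpa using ENat.LEInfty.out)).eq _ _
  rw [covAlong, covAlong.eq_def c f (fun y ↦ c.covAlong f s y (X y)), h.fderiv_covAlong hz hf hs hY,
    h.fderiv_covAlong hz hf hs hX, e1, e2]
  simp only [covAlong, curv, map_add, map_sub, add_apply, sub_apply]
  abel

theorem IsHermitianOn.covAlong_contDiffAt (h : c.IsHermitianOn U) (hz : f z ∈ U)
    (hf : ContDiffAt ℝ ∞ f z) (hs : ContDiffAt ℝ ∞ s z) {Y : E → E} (hY : ContDiffAt ℝ ∞ Y z) :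
    ContDiffAt ℝ ∞ (fun y ↦ c.covAlong f s y (Y y)) z := by
  have hdf : ContDiffAt ℝ ∞ (fderiv ℝ f) z := hf.fderiv_right (m := ∞) (by simp)
  have hds : ContDiffAt ℝ ∞ (fderiv ℝ s) z := hs.fderiv_right (m := ∞) (by simp)
  have hΓ := (h.contDiffOn_Γ.contDiffAt (h.isOpen.mem_nhds hz)).comp z hf
  exact (hds.clm_apply hY).add ((hΓ.clm_apply (hdf.clm_apply hY)).clm_apply hs)

/-- An almost holomorphic map in charts. -/
structure IsHolomorphicOn (c : LocalHermitianData E) (c' : LocalHermitianData F) (U : Set E)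
    (U' : Set F) (f : E → F) : Prop where
  mapsTo : Set.MapsTo f U U'
  contDiffOn : ContDiffOn ℝ ∞ f U
  fderiv_J : ∀ z ∈ U, ∀ v, fderiv ℝ f z (c.J z v) = c'.J (f z) (fderiv ℝ f z v)

variable {c : LocalHermitianData E} {c' : LocalHermitianData F} {U : Set E} {U' : Set F}

theorem isHolomorphicOn_id :
    IsHolomorphicOn c c U U (fun z ↦ z) where
  mapsTo := fun _ h ↦ h
  contDiffOn := contDiffOn_id
  fderiv_J := by simp

theorem IsHolomorphicOn.contDiffAt (hf : IsHolomorphicOn c c' U U' f) (hU : IsOpen U) (hz : z ∈ U) :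
    ContDiffAt ℝ ∞ f z := hf.contDiffOn.contDiffAt (hU.mem_nhds hz)

/-- The `(0,1)`-part of the second fundamental form of an almost holomorphic map vanishes. -/
theorem IsHolomorphicOn.second_fderiv (hf : IsHolomorphicOn c c' U U' f) (h : c.IsHermitianOn U)
    (h' : c'.IsHermitianOn U') (hz : z ∈ U) (a b : E) :
    fderiv ℝ (fderiv ℝ f) z a b + c'.J (f z) (fderiv ℝ (fderiv ℝ f) z (c.J z a) b)
      + (c'.Γ (f z) (fderiv ℝ f z a) (fderiv ℝ f z b)
        + c'.J (f z) (c'.Γ (f z) (c'.J (f z) (fderiv ℝ f z a)) (fderiv ℝ f z b)))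
      = fderiv ℝ f z (c.Γ z a b + c.J z (c.Γ z (c.J z a) b)) := by
  have hfz := hf.contDiffAt h.isOpen hz
  have hz' := hf.mapsTo hz
  have hdf : HasFDerivAt (fderiv ℝ f) (fderiv ℝ (fderiv ℝ f) z) z :=
    ((hfz.fderiv_right (m := ∞) (by simp)).differentiableAt (by simp)).hasFDerivAt
  have hf1 := (hfz.differentiableAt (by simp)).hasFDerivAt
  have hsymm (a b : E) : fderiv ℝ (fderiv ℝ f) z a b = fderiv ℝ (fderiv ℝ f) z b a :=
    (hfz.isSymmSndFDerivAt (by simpa using ENat.LEInfty.out)).eq _ _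
  -- The derivative of the relation `df ∘ J = J' ∘ df`, which holds on a neighbourhood of `z`.
  have hder (v b : E) : fderiv ℝ (fderiv ℝ f) z v (c.J z b) + fderiv ℝ f z (fderiv ℝ c.J z v b)
      = fderiv ℝ c'.J (f z) (fderiv ℝ f z v) (fderiv ℝ f z b)
        + c'.J (f z) (fderiv ℝ (fderiv ℝ f) z v b) := by
    have e1 := (hdf.clm_apply ((h.hasFDerivAt_J hz).clm_apply (hasFDerivAt_const b z)))
    have e2 := ((h'.hasFDerivAt_J hz').comp z hf1).clm_apply (hdf.clm_apply (hasFDerivAt_const b z))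
    have e3 : (fun y ↦ fderiv ℝ f y (c.J y b)) =ᶠ[nhds z]
        fun y ↦ (c'.J ∘ f) y (fderiv ℝ f y b) := by
      filter_upwards [h.isOpen.mem_nhds hz] with y hy using hf.fderiv_J y hy b
    have e4 := congrArg (fun L ↦ L v) ((e1.congr_of_eventuallyEq e3.symm).unique e2)
    simp at e4
    rw [add_comm, e4]
    abel
  set A := fderiv ℝ f z
  -- `H` is the second fundamental form `∇df`. It is `J`-linear in its second argument because both
  -- almost complex structures are parallel.
  set H : E → E → F := fun v b ↦ fderiv ℝ (fderiv ℝ f) z v b + c'.Γ (f z) (A v) (A b) - A (c.Γ z v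
    b)
    with hH
  have hJ (v : E) : A (c.J z v) = c'.J (f z) (A v) := hf.fderiv_J z hz v
  have HJ (v b : E) : H v (c.J z b) = c'.J (f z) (H v b) := by
    have e1 := congrArg A (h.parallel z hz v b)
    have e2 := h'.parallel _ hz' (A v) (A b)
    have e3 := hder v b
    simp only [map_add, hJ] at e1
    simp only [hH, map_add, map_sub, hJ]
    rw [← e1, ← e2, ← sub_eq_zero]
    rw [← sub_eq_zero] at e3
    rw [← e3]
    abel
  -- The antisymmetric part of `H` is a difference of torsions, and adding its values at `(a, b)`
  -- and `(Ja, Jb)` gives zero.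
  have Hsw (a b : E) : H a b + c'.J (f z) (H (c.J z a) b) = H b a + c'.J (f z) (H (c.J z b) a) := by
    rw [← HJ, ← HJ]
    have e1 := congrArg A (h.torsion_add z hz a b)
    have e2 := h'.torsion_add _ hz' (A a) (A b)
    simp only [map_add, map_sub, map_zero] at e1
    simp only [hH, hJ, hsymm b a, hsymm (c.J z b)]
    linear_combination (norm := module) e2 - e1
  have HJl (a b : E) : H (c.J z (c.J z a)) b = - H a b := by
    simp only [hH, h.J_sq z hz, map_neg, neg_apply]
    abel
  -- The form `P a b = H a b + J' (H (Ja) b)` is symmetric, `J`-linear in `b` and conjugate linear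
  -- in `a`. Symmetry makes it both linear and conjugate linear in `a`, hence zero.
  have key : c'.J (f z) (H a b + c'.J (f z) (H (c.J z a) b)) = 0 := by
    have e1 := Hsw (c.J z a) b
    have e2 := Hsw a b
    rw [HJl, HJ, HJ, map_neg] at e1
    have e3 := congrArg (c'.J (f z)) e2
    simp only [map_add, h'.J_sq _ hz'] at e1 e3 ⊢
    linear_combination (norm := module) (1 / 2 : ℝ) • e3 - (1 / 2 : ℝ) • e1
  have := congrArg (c'.J (f z)) key
  rw [h'.J_sq _ hz', map_zero, neg_eq_zero] at this
  simp only [hH, map_add, map_sub, hJ] at this ⊢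
  rw [← sub_eq_zero, ← this]
  abel

end Flat
end LocalHermitianData

/-! ### The Bochner formula -/

namespace LocalHermitianData

section Bochner

set_option maxSynthPendingDepth 3

variable {E : Type*} [NormedAddCommGroup E] [NormedSpace ℝ E]
  {F : Type*} [NormedAddCommGroup F] [NormedSpace ℝ F]
  {c : LocalHermitianData E} {c' : LocalHermitianData F} {U : Set E} {U' : Set F} {f : E → F}
  {X : E → E} {z : E}

/-- `X (X φ) + JX (JX φ)`. -/
noncomputable def lap (c : LocalHermitianData E) (X : E → E) (φ : E → ℝ) (z : E) : ℝ :=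
  fderiv ℝ (fun y ↦ fderiv ℝ φ y (X y)) z (X z)
    + fderiv ℝ (fun y ↦ fderiv ℝ φ y (c.J y (X y))) z (c.J z (X z))

/-- The real field corresponding to `2 ∇_{X^{0,1}} X^{1,0}`. -/
noncomputable def dbar (c : LocalHermitianData E) (X : E → E) (z : E) : E :=
  fderiv ℝ X z (X z) + c.Γ z (X z) (X z)
    + c.J z (fderiv ℝ X z (c.J z (X z)) + c.Γ z (c.J z (X z)) (X z))

/-- The vector corresponding to `4 ∇_{X^{1,0}} ∇_{X^{0,1}} X^{1,0}` at a zero of `dbar X`. -/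
noncomputable def dDbar (c : LocalHermitianData E) (X : E → E) (z : E) : E :=
  fderiv ℝ (c.dbar X) z (X z) - c.J z (fderiv ℝ (c.dbar X) z (c.J z (X z)))

theorem IsHermitianOn.contDiffAt_JX (h : c.IsHermitianOn U) (hX : ContDiffAt ℝ ∞ X z)
    (hz : z ∈ U) : ContDiffAt ℝ ∞ (fun y ↦ c.J y (X y)) z :=
  (h.contDiffOn_J.contDiffAt (h.isOpen.mem_nhds hz)).clm_apply hX

theorem IsHermitianOn.contDiffAt_dbar (h : c.IsHermitianOn U) (hX : ContDiffAt ℝ ∞ X z)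
    (hz : z ∈ U) : ContDiffAt ℝ ∞ (c.dbar X) z := by
  have hd : ContDiffAt ℝ ∞ (fderiv ℝ X) z := hX.fderiv_right (m := ∞) (by simp)
  have hJ := h.contDiffOn_J.contDiffAt (h.isOpen.mem_nhds hz)
  have hΓ := h.contDiffOn_Γ.contDiffAt (h.isOpen.mem_nhds hz)
  have hJX := h.contDiffAt_JX hX hz
  exact ((hd.clm_apply hX).add ((hΓ.clm_apply hX).clm_apply hX)).add
    (hJ.clm_apply ((hd.clm_apply hJX).add ((hΓ.clm_apply hJX).clm_apply hX)))

theorem IsHermitianOn.fderiv_JX_of_parallel (h : c.IsHermitianOn U) (hX : ContDiffAt ℝ ∞ X z)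
    (hz : z ∈ U) (h0 : ∀ v, fderiv ℝ X z v + c.Γ z v (X z) = 0) (v : E) :
    fderiv ℝ (fun y ↦ c.J y (X y)) z v + c.Γ z v (c.J z (X z)) = 0 := by
  have := h.covAlong_J (f := fun z ↦ z) (v := v) hz differentiableAt_id (hX.differentiableAt (by
    simp))
  simpa [covAlong, h0] using this

/-- For `b = Ja` the two torsion terms coincide because `J² = -1`, so twice the torsion of `(a, Ja)`
is zero. -/
theorem IsHermitianOn.torsion_J (h : c.IsHermitianOn U) (hz : z ∈ U) (a : E) :
    c.Γ z a (c.J z a) = c.Γ z (c.J z a) a := by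
  have := h.torsion_add z hz a (c.J z a)
  simp only [h.J_sq z hz, map_neg, neg_apply] at this
  linear_combination (norm := module) (1 / 2 : ℝ) • this

variable (hf : IsHolomorphicOn c c' U U' f) (h : c.IsHermitianOn U)
    (h' : c'.IsHermitianOn U') (hX : ∀ z ∈ U, ContDiffAt ℝ ∞ X z)
include hf h hX

theorem IsHolomorphicOn.contDiffAt_fderiv_apply (hz : z ∈ U) :
    ContDiffAt ℝ ∞ (fun y ↦ fderiv ℝ f y (X y)) z :=
  ((hf.contDiffAt h.isOpen hz).fderiv_right (m := ∞) (by simp)).clm_apply (hX z hz)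

include h'

/-- By the product rule the difference of the two sides is the `(0,1)`-part of the second
fundamental form at `(X, X)`, which vanishes by `second_fderiv`. -/
theorem IsHolomorphicOn.dbar_fderiv (hz : z ∈ U) :
    c'.covAlong f (fun y ↦ fderiv ℝ f y (X y)) z (X z)
      + c'.J (f z) (c'.covAlong f (fun y ↦ fderiv ℝ f y (X y)) z (c.J z (X z)))
      = fderiv ℝ f z (c.dbar X z) := by
  have hdf : HasFDerivAt (fderiv ℝ f) (fderiv ℝ (fderiv ℝ f) z) z :=
    (((hf.contDiffAt h.isOpen hz).fderiv_right (m := ∞) (by simp)).differentiableAt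
      (by simp)).hasFDerivAt
  have e := (hdf.clm_apply ((hX z hz).differentiableAt (by simp)).hasFDerivAt).fderiv
  have e2 := hf.second_fderiv h h' hz (X z) (X z)
  simp only [covAlong, e, dbar, map_add, hf.fderiv_J z hz, add_apply,
    ContinuousLinearMap.flip_apply, ContinuousLinearMap.comp_apply] at e2 ⊢
  linear_combination (norm := module) e2

/-- Bochner formula for the energy density of an almost holomorphic map in the direction of a
vector field that is parallel at `z`. -/
theorem IsHolomorphicOn.lap_energy (hz : z ∈ U)
    (h0 : ∀ v, fderiv ℝ X z v + c.Γ z v (X z) = 0) :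
    c.lap X (fun y ↦ c'.G (f y) (fderiv ℝ f y (X y)) (fderiv ℝ f y (X y))) z =
      2 * c'.G (f z) (fderiv ℝ f z (c.dDbar X z)) (fderiv ℝ f z (X z))
      - 2 * c'.G (f z) (c'.J (f z) (c'.curv (f z) (fderiv ℝ f z (X z))
          (c'.J (f z) (fderiv ℝ f z (X z))) (fderiv ℝ f z (X z)))) (fderiv ℝ f z (X z))
      + 2 * (c'.G (f z) (c'.covAlong f (fun y ↦ fderiv ℝ f y (X y)) z (X z))
          (c'.covAlong f (fun y ↦ fderiv ℝ f y (X y)) z (X z))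
        + c'.G (f z) (c'.covAlong f (fun y ↦ fderiv ℝ f y (X y)) z (c.J z (X z)))
          (c'.covAlong f (fun y ↦ fderiv ℝ f y (X y)) z (c.J z (X z)))) := by
  have hfz (y) (hy : y ∈ U) := hf.contDiffAt h.isOpen hy
  have hfd (y) (hy : y ∈ U) : DifferentiableAt ℝ f y := (hfz y hy).differentiableAt (by simp)
  have hU : ∀ᶠ y in nhds z, y ∈ U := h.isOpen.mem_nhds hz
  have hW (y) (hy : y ∈ U) : ContDiffAt ℝ ∞ (fun y ↦ fderiv ℝ f y (X y)) y :=
    hf.contDiffAt_fderiv_apply h hX hy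
  have hDbar (y) (hy : y ∈ U) := hf.dbar_fderiv h h' hX hy
  set W : E → F := fun y ↦ fderiv ℝ f y (X y)
  have hWd (y) (hy : y ∈ U) : DifferentiableAt ℝ W y := (hW y hy).differentiableAt (by simp)
  have second (Y : E → E) (hY : ContDiffAt ℝ ∞ Y z) :
      fderiv ℝ (fun y ↦ fderiv ℝ (fun y ↦ c'.G (f y) (W y) (W y)) y (Y y)) z (Y z)
        = 2 * c'.G (f z) (c'.covAlong f (fun y ↦ c'.covAlong f W y (Y y)) z (Y z)) (W z)
          + 2 * c'.G (f z) (c'.covAlong f W z (Y z)) (c'.covAlong f W z (Y z)) := by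
    have e : (fun y ↦ fderiv ℝ (fun y ↦ c'.G (f y) (W y) (W y)) y (Y y)) =ᶠ[nhds z]
        fun y ↦ (2 : ℝ) • c'.G (f y) (c'.covAlong f W y (Y y)) (W y) := by
      filter_upwards [hU] with y hy
      rw [h'.fderiv_G_along (hf.mapsTo hy) (hfd y hy) (hWd y hy) (hWd y hy),
        h'.symm _ (hf.mapsTo hy) (W y), smul_eq_mul, two_mul]
    have hS := (h'.covAlong_contDiffAt (hf.mapsTo hz) (hfz z hz) (hW z hz) hY).differentiableAt
      (by simp)
    have hG : DifferentiableAt ℝ (fun y ↦ c'.G (f y) (c'.covAlong f W y (Y y)) (W y)) z :=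
      ((DifferentiableAt.clm_apply (DifferentiableAt.comp (g := c'.G) z
        (h'.hasFDerivAt_G (hf.mapsTo hz)).differentiableAt (hfd z hz)) hS).clm_apply (hWd z hz))
    rw [e.fderiv_eq, fderiv_fun_const_smul hG]
    simp [h'.fderiv_G_along (hf.mapsTo hz) (hfd z hz) hS (hWd z hz)]
    ring
  have hJX := h.contDiffAt_JX (hX z hz) hz
  rw [lap, second X (hX z hz), second (fun y ↦ c.J y (X y)) hJX]
  have hS1 := (h'.covAlong_contDiffAt (hf.mapsTo hz) (hfz z hz) (hW z hz) (hX z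
    hz)).differentiableAt
      (by simp)
  have hS2 := (h'.covAlong_contDiffAt (hf.mapsTo hz) (hfz z hz) (hW z hz) hJX).differentiableAt
      (by simp)
  have hB0 : c.dbar X z = 0 := by simp [dbar, h0]
  have hBd := ((h.contDiffAt_dbar (hX z hz) hz).differentiableAt (by simp)).hasFDerivAt
  have hdf : HasFDerivAt (fderiv ℝ f) (fderiv ℝ (fderiv ℝ f) z) z :=
    (((hf.contDiffAt h.isOpen hz).fderiv_right (m := ∞) (by simp)).differentiableAt
      (by simp)).hasFDerivAt
  -- The identity `hDbar` holds near `z`, so it may be differentiated covariantly. On the right the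
  -- terms with `D²f` and `Γ'` drop out because `dbar X` vanishes at `z`.
  have hcov (v : E) : c'.covAlong f (fun y ↦ c'.covAlong f W y (X y)) z v
      + c'.J (f z) (c'.covAlong f (fun y ↦ c'.covAlong f W y (c.J y (X y))) z v)
      = fderiv ℝ f z (fderiv ℝ (c.dbar X) z v) := by
    have hJS2 : DifferentiableAt ℝ (fun y ↦ c'.J (f y) (c'.covAlong f W y (c.J y (X y)))) z :=
      DifferentiableAt.clm_apply (DifferentiableAt.comp (g := c'.J) z
        (h'.hasFDerivAt_J (hf.mapsTo hz)).differentiableAt (hfd z hz)) hS2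
    rw [← h'.covAlong_J (hf.mapsTo hz) (hfd z hz) hS2, ← covAlong_add hS1 hJS2]
    have e : (fun y ↦ c'.covAlong f W y (X y) + c'.J (f y) (c'.covAlong f W y (c.J y (X y))))
        =ᶠ[nhds z] fun y ↦ fderiv ℝ f y (c.dbar X y) := by
      filter_upwards [hU] with y hy using hDbar y hy
    rw [covAlong_congr e, covAlong, (hdf.clm_apply hBd).fderiv]
    simp [hB0]
  have hcomm := h'.covAlong_comm (hf.mapsTo hz) (hfz z hz) (hW z hz)
    ((hX z hz).differentiableAt (by simp)) (hJX.differentiableAt (by simp))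
  -- The bracket `[X, JX]` vanishes at `z`: both fields are parallel there and their torsion is
  -- zero.
  have hbr : fderiv ℝ (fun y ↦ c.J y (X y)) z (X z) - fderiv ℝ X z (c.J z (X z)) = 0 := by
    have e1 := h.fderiv_JX_of_parallel (hX z hz) hz h0 (X z)
    have e2 := h0 (c.J z (X z))
    rw [h.torsion_J hz] at e1
    linear_combination (norm := module) e1 - e2
  rw [hbr, hf.fderiv_J z hz] at hcomm
  have hc0 : c'.covAlong f W z 0 = 0 := by simp [covAlong]
  rw [hc0, add_zero] at hcomm
  have e1 := hcov (X z)
  have e2 := congrArg (c'.J (f z)) (hcov (c.J z (X z)))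
  have e3 := congrArg (c'.J (f z)) hcomm
  rw [map_add, h'.J_sq _ (hf.mapsTo hz), ← hf.fderiv_J z hz] at e2
  rw [map_sub] at e3
  -- Combine `hcov` at `v = X` with `J'` applied to `hcov` at `v = JX`. The mixed derivatives form
  -- `J'` of a commutator, which `hcomm` identifies with curvature.
  have e4 : c'.covAlong f (fun y ↦ c'.covAlong f W y (X y)) z (X z)
      + c'.covAlong f (fun y ↦ c'.covAlong f W y (c.J y (X y))) z (c.J z (X z))
      = fderiv ℝ f z (c.dDbar X z) - c'.J (f z) (c'.curv (f z) (W z) (c'.J (f z) (W z)) (W z)) := by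
    rw [dDbar, map_sub]
    linear_combination (norm := module) e1 - e2 - e3
  have e5 := congrArg (fun w ↦ c'.G (f z) w (W z)) e4
  simp only [map_add, map_sub, add_apply, sub_apply] at e5
  linear_combination 2 * e5

end Bochner
end LocalHermitianData

/-! ### Second derivatives at a maximum and nonnegative quadratic forms -/

section SecondDerivative

variable {E : Type*} [NormedAddCommGroup E] [NormedSpace ℝ E] {φ ψ : E → ℝ} {z : E}

theorem ContDiffAt.eventually_differentiableAt_of_two {F : Type*} [NormedAddCommGroup F]
    [NormedSpace ℝ F] {φ : E → F} (hφ : ContDiffAt ℝ 2 φ z) :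
    ∀ᶠ y in nhds z, DifferentiableAt ℝ φ y := by
  filter_upwards [hφ.eventually (by simp)] with y hy using hy.differentiableAt (by simp)

theorem ContDiffAt.hasFDerivAt_fderiv_of_two (hφ : ContDiffAt ℝ 2 φ z) :
    HasFDerivAt (fderiv ℝ φ) (fderiv ℝ (fderiv ℝ φ) z) z :=
  ((hφ.fderiv_right (m := 1) (by norm_num)).differentiableAt (by simp)).hasFDerivAt

/-- The second derivative test. -/
theorem IsLocalMax.fderiv_fderiv_nonpos (hmax : IsLocalMax φ z) (hφ : ContDiffAt ℝ 2 φ z) (a : E) :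
    fderiv ℝ (fderiv ℝ φ) z a a ≤ 0 := by
  by_contra! hpos
  let l : ℝ → E := fun t ↦ z + t • a
  have hl (t : ℝ) : HasDerivAt l a t := by
    simpa [l] using ((hasDerivAt_id t).smul_const a).const_add z
  have hl0 : l 0 = z := by simp [l]
  have hlt : Filter.Tendsto l (nhds 0) (nhds z) := by
    simpa [hl0] using (hl 0).continuousAt.tendsto
  have e1 : deriv (φ ∘ l) =ᶠ[nhds 0] fun t ↦ fderiv ℝ φ (l t) a := by
    filter_upwards [hlt.eventually hφ.eventually_differentiableAt_of_two] with t ht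
    exact (ht.hasFDerivAt.comp_hasDerivAt t (hl t)).deriv
  have e2 : deriv (deriv (φ ∘ l)) 0 = fderiv ℝ (fderiv ℝ φ) z a a := by
    rw [e1.deriv_eq]
    have := hφ.hasFDerivAt_fderiv_of_two
    rw [← hl0] at this
    have := ((this.comp_hasDerivAt 0 (hl 0)).clm_apply (hasDerivAt_const 0 a)).deriv
    simpa [hl0] using this
  have hm : IsLocalMax (φ ∘ l) 0 := by
    have : ∀ᶠ t in nhds 0, φ (l t) ≤ φ z := hlt.eventually hmax
    filter_upwards [this] with t ht
    simpa [hl0] using ht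
  have hc : ContinuousAt (φ ∘ l) 0 := by
    refine ContinuousAt.comp ?_ (hl 0).continuousAt
    rw [hl0]; exact hφ.continuousAt
  -- A positive second derivative makes the local maximum also a local minimum along the line, so
  -- the restriction is locally constant and its second derivative is zero.
  have hmin := isLocalMin_of_deriv_deriv_pos (by rw [e2]; exact hpos) hm.deriv_eq_zero hc
  have hconst : (φ ∘ l) =ᶠ[nhds 0] fun _ ↦ (φ ∘ l) 0 := by
    filter_upwards [hm, hmin] with t h1 h2 using le_antisymm h1 h2
  have e3 : deriv (φ ∘ l) =ᶠ[nhds 0] fun _ ↦ 0 := by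
    have := hconst.deriv
    simpa using this
  have := e3.deriv_eq
  rw [e2] at this
  simp at this
  exact hpos.ne' this

/-- A vector on which a nonnegative quadratic form vanishes lies in its radical. -/
theorem LinearMap.BilinForm.apply_eq_zero_of_nonneg {V : Type*} [AddCommGroup V] [Module ℝ V]
    (Q : V →ₗ[ℝ] V →ₗ[ℝ] ℝ) (hs : ∀ a b, Q a b = Q b a) (hQ : ∀ a, 0 ≤ Q a a) {a : V}
    (ha : Q a a = 0) (b : V) : Q b a = 0 := by
  have key (t : ℝ) : 0 ≤ Q b b + 2 * t * Q b a := by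
    have := hQ (b + t • a)
    simp [ha, hs a b] at this
    linarith
  by_contra hne
  -- For this value of `t` the right side of `key` is `-1`.
  have := key (-(Q b b + 1) / (2 * Q b a))
  field_simp at this
  linarith

end SecondDerivative

/-! ### The estimate at a maximum point, in coordinates -/

namespace LocalHermitianData

section Maximum

set_option maxSynthPendingDepth 3

variable {E : Type*} [NormedAddCommGroup E] [NormedSpace ℝ E]
  {F : Type*} [NormedAddCommGroup F] [NormedSpace ℝ F]
  {c : LocalHermitianData E} {c' : LocalHermitianData F} {U : Set E} {U' : Set F} {f : E → F}
  {X : E → E} {z : E} {φ ψ : E → ℝ}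

theorem fderiv_fderiv_apply (hφ : ContDiffAt ℝ 2 φ z) (hX : DifferentiableAt ℝ X z) (v : E) :
    fderiv ℝ (fun y ↦ fderiv ℝ φ y (X y)) z v =
      fderiv ℝ (fderiv ℝ φ) z v (X z) + fderiv ℝ φ z (fderiv ℝ X z v) := by
  rw [(hφ.hasFDerivAt_fderiv_of_two.clm_apply hX.hasFDerivAt).fderiv]
  simp [add_comm]

theorem differentiableAt_fderiv_apply (hφ : ContDiffAt ℝ 2 φ z) (hX : DifferentiableAt ℝ X z) :
    DifferentiableAt ℝ (fun y ↦ fderiv ℝ φ y (X y)) z :=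
  (hφ.hasFDerivAt_fderiv_of_two.clm_apply hX.hasFDerivAt).differentiableAt

theorem lap_mul (hφ : ContDiffAt ℝ 2 φ z) (hψ : ContDiffAt ℝ 2 ψ z) (hX : DifferentiableAt ℝ X z)
    (hJX : DifferentiableAt ℝ (fun y ↦ c.J y (X y)) z) :
    c.lap X (fun y ↦ φ y * ψ y) z = φ z * c.lap X ψ z + ψ z * c.lap X φ z
      + 2 * (fderiv ℝ φ z (X z) * fderiv ℝ ψ z (X z)
        + fderiv ℝ φ z (c.J z (X z)) * fderiv ℝ ψ z (c.J z (X z))) := by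
  have key (Y : E → E) (hY : DifferentiableAt ℝ Y z) :
      fderiv ℝ (fun y ↦ fderiv ℝ (fun y ↦ φ y * ψ y) y (Y y)) z (Y z) =
        φ z * fderiv ℝ (fun y ↦ fderiv ℝ ψ y (Y y)) z (Y z)
        + ψ z * fderiv ℝ (fun y ↦ fderiv ℝ φ y (Y y)) z (Y z)
        + 2 * (fderiv ℝ φ z (Y z) * fderiv ℝ ψ z (Y z)) := by
    have e : (fun y ↦ fderiv ℝ (fun y ↦ φ y * ψ y) y (Y y)) =ᶠ[nhds z]
        fun y ↦ φ y * fderiv ℝ ψ y (Y y) + ψ y * fderiv ℝ φ y (Y y) := by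
      filter_upwards [hφ.eventually_differentiableAt_of_two,
        hψ.eventually_differentiableAt_of_two] with y h1 h2
      rw [fderiv_fun_mul h1 h2]
      simp
    have d1 := differentiableAt_fderiv_apply hφ hY
    have d2 := differentiableAt_fderiv_apply hψ hY
    have d3 := hφ.differentiableAt (by simp)
    have d4 := hψ.differentiableAt (by simp)
    rw [e.fderiv_eq, fderiv_fun_add (d3.fun_mul d2) (d4.fun_mul d1), fderiv_fun_mul d3 d2,
      fderiv_fun_mul d4 d1]
    simp
    ring
  have k1 := key X hX
  have k2 := key (fun y ↦ c.J y (X y)) hJX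
  simp only [lap, k1, k2]
  ring

theorem lap_sub (hφ : ContDiffAt ℝ 2 φ z) (hψ : ContDiffAt ℝ 2 ψ z) (hX : DifferentiableAt ℝ X z)
    (hJX : DifferentiableAt ℝ (fun y ↦ c.J y (X y)) z) :
    c.lap X (fun y ↦ φ y - ψ y) z = c.lap X φ z - c.lap X ψ z := by
  have key (Y : E → E) (hY : DifferentiableAt ℝ Y z) :
      fderiv ℝ (fun y ↦ fderiv ℝ (fun y ↦ φ y - ψ y) y (Y y)) z (Y z) =
        fderiv ℝ (fun y ↦ fderiv ℝ φ y (Y y)) z (Y z)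
        - fderiv ℝ (fun y ↦ fderiv ℝ ψ y (Y y)) z (Y z) := by
    have e : (fun y ↦ fderiv ℝ (fun y ↦ φ y - ψ y) y (Y y)) =ᶠ[nhds z]
        fun y ↦ fderiv ℝ φ y (Y y) - fderiv ℝ ψ y (Y y) := by
      filter_upwards [hφ.eventually_differentiableAt_of_two,
        hψ.eventually_differentiableAt_of_two] with y h1 h2
      rw [fderiv_fun_sub h1 h2]
      simp
    rw [e.fderiv_eq, fderiv_fun_sub (differentiableAt_fderiv_apply hφ hY)
      (differentiableAt_fderiv_apply hψ hY)]
    simp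
  have k1 := key X hX
  have k2 := key (fun y ↦ c.J y (X y)) hJX
  simp only [lap, k1, k2]
  ring

/-- The Levi form `(∇dφ)(a, a) + (∇dφ)(Ja, Ja)`. -/
noncomputable def levi (c : LocalHermitianData E) (φ : E → ℝ) (z a : E) : ℝ :=
  fderiv ℝ (fderiv ℝ φ) z a a - fderiv ℝ φ z (c.Γ z a a)
    + (fderiv ℝ (fderiv ℝ φ) z (c.J z a) (c.J z a) - fderiv ℝ φ z (c.Γ z (c.J z a) (c.J z a)))

/-- For `X` parallel at `z`, and then `JX` too, the first-order terms of the second derivatives are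
exactly the Christoffel terms of the Hessian. -/
theorem IsHermitianOn.lap_eq_levi (h : c.IsHermitianOn U) (hφ : ContDiffAt ℝ 2 φ z)
    (hX : ContDiffAt ℝ ∞ X z) (hz : z ∈ U) (h0 : ∀ v, fderiv ℝ X z v + c.Γ z v (X z) = 0) :
    c.lap X φ z = c.levi φ z (X z) := by
  have hJX := h.contDiffAt_JX hX hz
  rw [lap, fderiv_fderiv_apply hφ (hX.differentiableAt (by simp)),
    fderiv_fderiv_apply hφ (hJX.differentiableAt (by simp)), levi,
    eq_neg_of_add_eq_zero_left (h0 _),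
    eq_neg_of_add_eq_zero_left (h.fderiv_JX_of_parallel hX hz h0 _), map_neg, map_neg]
  ring

theorem lap_nonpos_of_isLocalMax (hφ : ContDiffAt ℝ 2 φ z) (hmax : IsLocalMax φ z)
    (hX : DifferentiableAt ℝ X z) (hJX : DifferentiableAt ℝ (fun y ↦ c.J y (X y)) z) :
    c.lap X φ z ≤ 0 := by
  rw [lap, fderiv_fderiv_apply hφ hX, fderiv_fderiv_apply hφ hJX, hmax.fderiv_eq_zero]
  have h1 := hmax.fderiv_fderiv_nonpos hφ (X z)
  have h2 := hmax.fderiv_fderiv_nonpos hφ (c.J z (X z))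
  simp only [zero_apply]
  linarith

/-- Matches the curvature term of the Bochner formula with a holomorphic sectional curvature, in the
direction `-Ja`. Only the isometry `J` and the antisymmetry of the curvature in its first two
arguments are needed. -/
theorem IsHermitianOn.G_J_curv (h : c.IsHermitianOn U) (hz : z ∈ U) (a : E) :
    c.G z (c.J z (c.curv z a (c.J z a) a)) a =
      c.G z (c.curv z (-c.J z a) (c.J z (-c.J z a)) (c.J z (-c.J z a))) (-c.J z a) := by
  rw [← h.G_J z hz _ (-c.J z a)]
  simp only [map_neg, h.J_sq z hz, neg_neg]
  congr 2
  simp only [curv, map_neg, neg_apply]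
  congr 1
  abel

set_option maxHeartbeats 1000000 in
/-- The main estimate at a maximum point of `η · |df|² / |·|²`. -/
theorem IsHolomorphicOn.max_estimate (hf : IsHolomorphicOn c c' U U' f) (h : c.IsHermitianOn U)
    (h' : c'.IsHermitianOn U') (hz : z ∈ U) {η : E → ℝ} (hη : ContDiffAt ℝ 2 η z) (hη0 : 0 < η z)
    {a : E} {Λ k₁ k₂ : ℝ} (hΛ : 0 ≤ Λ) (ha : c.G z a a = 1)
    (hΛa : c'.G (f z) (fderiv ℝ f z a) (fderiv ℝ f z a) = Λ)
    (hmax : ∀ᶠ y in nhds z, ∀ b,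
      η y * c'.G (f y) (fderiv ℝ f y b) (fderiv ℝ f y b) ≤ η z * Λ * c.G y b b)
    (hk₁ : ∀ b, -k₁ * (c.G z b b) ^ 2 ≤ c.G z (c.curv z b (c.J z b) (c.J z b)) b)
    (hk₂ : ∀ b, c'.G (f z) (c'.curv (f z) b (c'.J (f z) b) (c'.J (f z) b)) b ≤
      -k₂ * (c'.G (f z) b b) ^ 2) :
    2 * k₂ * Λ ^ 2 * η z + Λ * c.levi η z a ≤
      2 * Λ * ((fderiv ℝ η z a) ^ 2 + (fderiv ℝ η z (c.J z a)) ^ 2) / η z + 2 * k₁ * Λ * η z := by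
  have hz' := hf.mapsTo hz
  have hfz := hf.contDiffAt h.isOpen hz
  -- The affine extension of `a` whose covariant derivative vanishes at `z`.
  let X : E → E := fun y ↦ a - c.Γ z (y - z) a
  have hXc (y) (_ : y ∈ U) : ContDiffAt ℝ ∞ X y :=
    contDiffAt_const.sub (((c.Γ z).contDiff.contDiffAt.comp y
      (contDiffAt_id.sub contDiffAt_const)).clm_apply contDiffAt_const)
  have hXz : X z = a := by simp [X]
  have h0 (v : E) : fderiv ℝ X z v + c.Γ z v (X z) = 0 := by
    have e := (((c.Γ z).flip a).hasFDerivAt.comp z ((hasFDerivAt_id z).sub_const z)).const_sub a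
    have e' : HasFDerivAt X (-((c.Γ z).flip a).comp (.id ℝ E)) z := e
    rw [e'.fderiv, hXz]
    simp
  have hXd := (hXc z hz).differentiableAt (by simp)
  have hJX := h.contDiffAt_JX (hXc z hz) hz
  have hJXd := hJX.differentiableAt (by simp)
  have hW := hf.contDiffAt_fderiv_apply h hXc hz
  have hBoch := hf.lap_energy h h' hXc hz h0
  -- The Bochner formula for the identity computes `X X + JX JX` of `|X|²`; its gradient terms are
  -- zero since `X` is parallel at `z`.
  have hBoch₀ := (isHolomorphicOn_id (c := c) (U := U)).lap_energy h h hXc hz h0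
  have hdh (v : E) := h'.fderiv_G_along (v := v) hz' (hfz.differentiableAt (by simp))
    (hW.differentiableAt (by simp)) (hW.differentiableAt (by simp))
  have hdk (v : E) := h.fderiv_G_along (v := v) (f := fun y ↦ y) hz differentiableAt_id hXd hXd
  have hcov (v : E) : c.covAlong (fun y ↦ y) X z v = 0 := by simpa [covAlong] using h0 v
  simp only [fderiv_fun_id, ContinuousLinearMap.id_apply, hcov, map_zero, zero_apply, add_zero,
    mul_zero] at hBoch₀ hdk
  have hhc : ContDiffAt ℝ 2 (fun y ↦ c'.G (f y) (fderiv ℝ f y (X y)) (fderiv ℝ f y (X y))) z :=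
    (((ContDiffAt.comp (g := c'.G) z (h'.contDiffOn_G.contDiffAt (h'.isOpen.mem_nhds hz'))
      hfz).clm_apply
      hW).clm_apply hW).of_le (mod_cast ENat.LEInfty.out)
  have hkc : ContDiffAt ℝ 2 (fun y ↦ c.G y (X y) (X y)) z :=
    (((h.contDiffOn_G.contDiffAt (h.isOpen.mem_nhds hz)).clm_apply
      (hXc z hz)).clm_apply (hXc z hz)).of_le (mod_cast ENat.LEInfty.out)
  have hhz : c'.G (f z) (fderiv ℝ f z (X z)) (fderiv ℝ f z (X z)) = Λ := by rw [hXz, hΛa]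
  have hkz : c.G z (X z) (X z) = 1 := by rw [hXz, ha]
  rw [hXz] at hBoch hBoch₀
  set W : E → F := fun y ↦ fderiv ℝ f y (X y)
  set hh : E → ℝ := fun y ↦ c'.G (f y) (W y) (W y)
  set kk : E → ℝ := fun y ↦ c.G y (X y) (X y)
  have hloc : IsLocalMax (fun y ↦ η y * hh y - (η z * Λ) * kk y) z := by
    filter_upwards [hmax] with y hy
    have : η z * hh z - η z * Λ * kk z = 0 := by simp only [hh, kk, W, hhz, hkz]; ring
    rw [this]
    simpa using hy (X y)
  have hlap := lap_nonpos_of_isLocalMax (c := c) ((hη.mul hhc).sub (contDiffAt_const.mul hkc)) hloc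
    hXd hJXd
  have hdF := hloc.fderiv_eq_zero
  have dη := hη.differentiableAt (by simp)
  have dh := hhc.differentiableAt (by simp)
  have dk := hkc.differentiableAt (by simp)
  -- The first-order condition at the maximum; `|X|²` does not contribute because its differential
  -- vanishes at `z`.
  have hdF' (v : E) : η z * fderiv ℝ hh z v + Λ * fderiv ℝ η z v = 0 := by
    have := DFunLike.congr_fun hdF v
    rw [fderiv_fun_sub (dη.fun_mul dh) (dk.const_mul _), fderiv_fun_mul dη dh, fderiv_const_mul
      dk] at this
    simpa [hdk, hhz, hh, W, kk] using this
  have e1 := lap_sub (c := c) (hη.mul hhc) (contDiffAt_const (c := η z * Λ) |>.mul hkc) hXd hJXd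
  have e2 := lap_mul (c := c) hη hhc hXd hJXd
  have e3 := lap_mul (c := c) (contDiffAt_const (c := η z * Λ)) hkc hXd hJXd
  have e4 : c.lap X (fun _ ↦ η z * Λ) z = 0 := by simp [lap]
  have e5 := h.lap_eq_levi hη (hXc z hz) hz h0
  -- The form `Λ G - f^* G'` at `z` is nonnegative by `hmax` at `y = z` and vanishes on `a`. Hence
  -- `a` is orthogonal to `dDbar X` for it, so the uncontrolled terms of the two Bochner formulas
  -- cancel.
  have hQ := LinearMap.BilinForm.apply_eq_zero_of_nonneg
    (Λ • (ContinuousLinearMap.coeLM ℝ ∘ₗ (c.G z : E →ₗ[ℝ] E →L[ℝ] ℝ)) -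
     (ContinuousLinearMap.coeLM ℝ ∘ₗ (c'.G (f z) : F →ₗ[ℝ] F →L[ℝ] ℝ)).compl₁₂
      (fderiv ℝ f z : E →ₗ[ℝ] F) (fderiv ℝ f z : E →ₗ[ℝ] F)) (a := a)
      (fun x y ↦ by simp [h.symm z hz x y, h'.symm _ hz' (fderiv ℝ f z x)])
      (fun x ↦ by
        have := hmax.self_of_nhds x
        rw [mul_assoc] at this
        simpa using le_of_mul_le_mul_left this hη0) (by simp [ha, hΛa]) (c.dDbar X z)
  -- The direction is `-J` of the relevant vector, as `G_J_curv` requires.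
  have r1 := hk₂ (-c'.J (f z) (fderiv ℝ f z a))
  have r2 := hk₁ (-c.J z a)
  rw [← h'.G_J_curv hz'] at r1
  rw [← h.G_J_curv hz] at r2
  simp only [map_neg, neg_apply, neg_neg, h.G_J z hz, h'.G_J _ hz', ha, hΛa] at r1 r2
  have p1 := h'.nonneg _ hz' (c'.covAlong f W z a)
  have p2 := h'.nonneg _ hz' (c'.covAlong f W z (c.J z a))
  have d1 := hdF' a
  have d2 := hdF' (c.J z a)
  rw [hXz] at e2 e5
  simp at hQ
  have d1' : fderiv ℝ hh z a = - Λ * fderiv ℝ η z a / η z := by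
    field_simp; linarith
  have d2' : fderiv ℝ hh z (c.J z a) = - Λ * fderiv ℝ η z (c.J z a) / η z := by
    field_simp; linarith
  have hhz' : hh z = Λ := hhz
  rw [e1, e2, e3, e4, d1', d2', e5, hhz'] at hlap
  simp only [fderiv_fun_const, Pi.zero_apply, zero_apply, zero_mul, add_zero, mul_zero] at hlap
  have hBh : 2 * Λ * c.G z (c.dDbar X z) a + 2 * k₂ * Λ ^ 2 ≤ c.lap X hh z := by
    rw [hBoch]; nlinarith
  have hBk : c.lap X kk z ≤ 2 * c.G z (c.dDbar X z) a + 2 * k₁ := by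
    rw [hBoch₀]; nlinarith
  have m1 := mul_le_mul_of_nonneg_left hBh hη0.le
  have m2 := mul_le_mul_of_nonneg_left hBk (mul_nonneg hη0.le hΛ)
  -- The cross terms of `lap (η h)`, after the first-order condition has eliminated `dh`.
  have e6 : 2 * (fderiv ℝ η z a * (-Λ * fderiv ℝ η z a / η z)
      + fderiv ℝ η z (c.J z a) * (-Λ * fderiv ℝ η z (c.J z a) / η z)) =
      - (2 * Λ * ((fderiv ℝ η z a) ^ 2 + (fderiv ℝ η z (c.J z a)) ^ 2) / η z) := by
    field_simp; ring
  rw [e6] at hlap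
  linarith

end Maximum
end LocalHermitianData

/-! ### Tangent vectors and vector fields in a chart -/

namespace AlmostHermitianStructure

section Chart

set_option maxSynthPendingDepth 3

variable {E : Type*} [NormedAddCommGroup E] [NormedSpace ℝ E]
  {M : Type*} [TopologicalSpace M] [ChartedSpace E M] [IsManifold 𝓘(ℝ, E) ∞ M]

/-- The coordinate isomorphism `T_y M → E` for the chart at `p`. -/
noncomputable def toCoord (p y : M) : TangentSpace 𝓘(ℝ, E) y →L[ℝ] E :=
  (trivializationAt E (TangentSpace 𝓘(ℝ, E)) p).continuousLinearMapAt ℝ y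

/-- The coordinate isomorphism `E → T_y M` for the chart at `p`. -/
noncomputable def ofCoord (p y : M) : E →L[ℝ] TangentSpace 𝓘(ℝ, E) y :=
  (trivializationAt E (TangentSpace 𝓘(ℝ, E)) p).symmL ℝ y

/-- The vector field with coordinates `s` in the chart at `p`. -/
noncomputable def chartSection (p : M) (s : E → E) (y : M) : TangentSpace 𝓘(ℝ, E) y :=
  ofCoord p y (s (extChartAt 𝓘(ℝ, E) p y))

variable {p y : M}

theorem toCoord_ofCoord (hy : y ∈ (chartAt E p).source) (v : E) : toCoord p y (ofCoord p y v) = v :=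
  Bundle.Trivialization.continuousLinearMapAt_symmL _ (by simpa using hy) v

theorem ofCoord_toCoord (hy : y ∈ (chartAt E p).source) (v : TangentSpace 𝓘(ℝ, E) y) :
    ofCoord p y (toCoord p y v) = v :=
  Bundle.Trivialization.symmL_continuousLinearMapAt _ (by simpa using hy) v

theorem toCoord_eq_mfderiv (hy : y ∈ (chartAt E p).source) :
    toCoord p y = mfderiv 𝓘(ℝ, E) 𝓘(ℝ, E) (extChartAt 𝓘(ℝ, E) p) y :=
  TangentBundle.continuousLinearMapAt_trivializationAt hy

/-- The extensions used to define curvature and Hessian have constant coordinates in the chart at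
`p`, which reduces both to coordinate formulas. -/
theorem extend_eq_chartSection (hy : y ∈ (chartAt E p).source) (v : TangentSpace 𝓘(ℝ, E) p) :
    FiberBundle.extend E v y = chartSection p (fun _ ↦ toCoord p p v) y := by
  rw [toCoord, Bundle.Trivialization.continuousLinearMapAt_apply,
    Bundle.Trivialization.linearMapAt_apply, if_pos (FiberBundle.mem_baseSet_trivializationAt' p)]
  exact (Bundle.Trivialization.symmL_apply _ (by simpa using hy) _).symm

theorem chartSection_toCoord (hy : y ∈ (chartAt E p).source) (X : ∀ y : M, TangentSpace 𝓘(ℝ, E) y) :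
    chartSection p (fun z ↦ toCoord p ((extChartAt 𝓘(ℝ, E) p).symm z)
      (X ((extChartAt 𝓘(ℝ, E) p).symm z))) y = X y := by
  have : (extChartAt 𝓘(ℝ, E) p).symm (extChartAt 𝓘(ℝ, E) p y) = y :=
    (extChartAt 𝓘(ℝ, E) p).left_inv (by simpa using hy)
  rw [chartSection, this, ofCoord_toCoord hy]

omit [IsManifold 𝓘(ℝ, E) ∞ M] in
theorem chart_left_inv (hy : y ∈ (chartAt E p).source) :
    (extChartAt 𝓘(ℝ, E) p).symm (extChartAt 𝓘(ℝ, E) p y) = y :=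
  (extChartAt 𝓘(ℝ, E) p).left_inv (by simpa using hy)

theorem trivializationAt_chartSection (hy : y ∈ (chartAt E p).source) (s : E → E) :
    (trivializationAt E (TangentSpace 𝓘(ℝ, E)) p ⟨y, chartSection p s y⟩).2 =
      s (extChartAt 𝓘(ℝ, E) p y) := by
  have := toCoord_ofCoord hy (s (extChartAt 𝓘(ℝ, E) p y))
  rwa [toCoord, Bundle.Trivialization.continuousLinearMapAt_apply,
    Bundle.Trivialization.linearMapAt_apply, if_pos (by simpa using hy)] at this

theorem contMDiffAt_chartSection {s : E → E} (hy : y ∈ (chartAt E p).source)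
    (hs : ContDiffAt ℝ ∞ s (extChartAt 𝓘(ℝ, E) p y)) :
    ContMDiffAt 𝓘(ℝ, E) (𝓘(ℝ, E).prod 𝓘(ℝ, E)) ∞ (T% (chartSection p s)) y := by
  have : IsManifold 𝓘(ℝ, E) (∞ + 1) M := by simpa
  rw [(trivializationAt E (TangentSpace 𝓘(ℝ, E)) p).contMDiffAt_section_iff (by simpa using hy)]
  have h : ContMDiffAt 𝓘(ℝ, E) 𝓘(ℝ, E) ∞ (s ∘ extChartAt 𝓘(ℝ, E) p) y :=
    hs.contMDiffAt.comp y (contMDiffAt_extChartAt' hy)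
  refine h.congr_of_eventuallyEq ?_
  filter_upwards [(chartAt E p).open_source.mem_nhds hy] with x hx
  exact trivializationAt_chartSection hx s

theorem mdifferentiableAt_chartSection {s : E → E} (hy : y ∈ (chartAt E p).source)
    (hs : DifferentiableAt ℝ s (extChartAt 𝓘(ℝ, E) p y)) : MDiffAt (T% (chartSection p s)) y := by
  rw [(trivializationAt E (TangentSpace 𝓘(ℝ, E)) p).mdifferentiableAt_section_iff 𝓘(ℝ, E) _
    (by simpa using hy)]
  have h : MDiffAt (s ∘ extChartAt 𝓘(ℝ, E) p) y :=
    MDifferentiableAt.comp y hs.mdifferentiableAt (mdifferentiableAt_extChartAt hy)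
  refine h.congr_of_eventuallyEq ?_
  filter_upwards [(chartAt E p).open_source.mem_nhds hy] with x hx
  exact trivializationAt_chartSection hx s

omit [IsManifold 𝓘(ℝ, E) ∞ M] in
theorem extChartAt_mem_target (hy : y ∈ (chartAt E p).source) :
    extChartAt 𝓘(ℝ, E) p y ∈ (extChartAt 𝓘(ℝ, E) p).target :=
  (extChartAt 𝓘(ℝ, E) p).map_source (by simpa using hy)

omit [IsManifold 𝓘(ℝ, E) ∞ M] in
theorem extChartAt_symm_mem {z : E} (hz : z ∈ (extChartAt 𝓘(ℝ, E) p).target) :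
    (extChartAt 𝓘(ℝ, E) p).symm z ∈ (chartAt E p).source := by
  simpa using (extChartAt 𝓘(ℝ, E) p).map_target hz

theorem contMDiffAt_extChartAt_symm {z : E} (hz : z ∈ (extChartAt 𝓘(ℝ, E) p).target) :
    ContMDiffAt 𝓘(ℝ, E) 𝓘(ℝ, E) ∞ (extChartAt 𝓘(ℝ, E) p).symm z :=
  (contMDiffOn_extChartAt_symm p).contMDiffAt ((isOpen_extChartAt_target p).mem_nhds hz)

omit [IsManifold 𝓘(ℝ, E) ∞ M] in
theorem comp_extChartAt_symm_comp_extChartAt {G : Type*} (u : M → G)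
    (hy : y ∈ (chartAt E p).source) :
    (u ∘ (extChartAt 𝓘(ℝ, E) p).symm) ∘ extChartAt 𝓘(ℝ, E) p =ᶠ[nhds y] u := by
  filter_upwards [(chartAt E p).open_source.mem_nhds hy] with x hx
  simp [(chartAt E p).left_inv hx]

theorem differentiableAt_comp_extChartAt_symm {G : Type*} [NormedAddCommGroup G] [NormedSpace ℝ G]
    {u : M → G} (hy : y ∈ (chartAt E p).source) (hu : MDiffAt u y) :
    DifferentiableAt ℝ (u ∘ (extChartAt 𝓘(ℝ, E) p).symm) (extChartAt 𝓘(ℝ, E) p y) := by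
  have hl : (extChartAt 𝓘(ℝ, E) p).symm (extChartAt 𝓘(ℝ, E) p y) = y :=
    (extChartAt 𝓘(ℝ, E) p).left_inv (by simpa using hy)
  rw [← mdifferentiableAt_iff_differentiableAt]
  refine MDifferentiableAt.comp _ (by rwa [hl]) ?_
  exact (contMDiffAt_extChartAt_symm (extChartAt_mem_target hy)).mdifferentiableAt (by simp)

theorem mvfderiv_eq_fderiv {G : Type*} [NormedAddCommGroup G] [NormedSpace ℝ G] {u : M → G}
    (hy : y ∈ (chartAt E p).source) (hu : MDiffAt u y) (v : TangentSpace 𝓘(ℝ, E) y) :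
    mvfderiv 𝓘(ℝ, E) u y v =
      fderiv ℝ (u ∘ (extChartAt 𝓘(ℝ, E) p).symm) (extChartAt 𝓘(ℝ, E) p y) (toCoord p y v) := by
  have hd := differentiableAt_comp_extChartAt_symm hy hu
  have h := mfderiv_comp_apply (I := 𝓘(ℝ, E)) (I' := 𝓘(ℝ, E)) (I'' := 𝓘(ℝ, G)) y
    hd.mdifferentiableAt (mdifferentiableAt_extChartAt hy) v
  rw [(comp_extChartAt_symm_comp_extChartAt u hy).mfderiv_eq, ← toCoord_eq_mfderiv hy,
    mfderiv_eq_fderiv] at h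
  exact h

/-- These fields are pullbacks of constant fields under the chart, and the bracket commutes with
pullback. -/
theorem mlieBracket_chartSection_const [CompleteSpace E] (hy : y ∈ (chartAt E p).source) (a b : E) :
    VectorField.mlieBracket 𝓘(ℝ, E) (chartSection p fun _ ↦ a) (chartSection p fun _ ↦ b) y = 0 :=
      by
  have : IsManifold 𝓘(ℝ, E) (minSmoothness ℝ 2) M := by
    rw [minSmoothness_of_isRCLikeNormedField]; infer_instance
  let K (a : E) : ∀ x : E, TangentSpace 𝓘(ℝ, E) x := fun _ ↦ a
  have hpull (a : E) : chartSection p (fun _ ↦ a) =ᶠ[nhds y]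
      VectorField.mpullback 𝓘(ℝ, E) 𝓘(ℝ, E) (extChartAt 𝓘(ℝ, E) p) (K a) := by
    filter_upwards [(chartAt E p).open_source.mem_nhds hy] with x hx
    have : (toCoord p x).inverse = ofCoord p x :=
      ContinuousLinearMap.inverse_eq (ContinuousLinearMap.ext fun v ↦ toCoord_ofCoord hx v)
        (ContinuousLinearMap.ext fun v ↦ ofCoord_toCoord hx v)
    have h2 := congrArg (fun L ↦ L (K a (extChartAt 𝓘(ℝ, E) p x))) this
    rw [toCoord_eq_mfderiv hx] at h2
    exact h2.symm
  have hconst (a : E) : MDiffAt (T% (K a)) (extChartAt 𝓘(ℝ, E) p y) :=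
    ((contMDiffAt_vectorSpace_iff_contDiffAt (n := 1)).2 contDiffAt_const).mdifferentiableAt (by
      simp)
  have hE : VectorField.mlieBracket 𝓘(ℝ, E) (K a) (K b) = fun _ ↦ 0 := by
    rw [← VectorField.mlieBracketWithin_univ, VectorField.mlieBracketWithin_eq_lieBracketWithin,
      VectorField.lieBracketWithin_univ]
    funext x
    simp [VectorField.lieBracket]
    rfl
  rw [(hpull a).mlieBracket_vectorField_eq (hpull b), ← VectorField.mpullback_mlieBracket
    (n := ∞) (hconst a) (hconst b) (contMDiffAt_extChartAt' hy) (by simpa using ENat.LEInfty.out),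
    VectorField.mpullback_apply, hE, map_zero]

end Chart
end AlmostHermitianStructure

/-! ### The Koszul formula in coordinates -/
namespace LocalHermitianData

section Koszul

set_option maxSynthPendingDepth 3

variable {E : Type*} [NormedAddCommGroup E] [NormedSpace ℝ E] {c : LocalHermitianData E} {z : E}

/-- Half of the vector `Γ a b + J Γ (J a) b`, expressed through the derivative of `J`. -/
noncomputable def mixed (c : LocalHermitianData E) (z a b : E) : E :=
  (1 / 4 : ℝ) • (fderiv ℝ c.J z (c.J z a) b - fderiv ℝ c.J z (c.J z b) a
    - c.J z (fderiv ℝ c.J z b a) - c.J z (fderiv ℝ c.J z a b))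

/-- Parallelism of `J` writes `dJ` as a commutator of `J` with the Christoffel symbols; the torsion
condition at `(a, b)` and `(a, Jb)` then removes the terms with exchanged arguments. -/
theorem two_smul_mixed (hJ : ∀ a, c.J z (c.J z a) = -a)
    (hpar : ∀ v a, fderiv ℝ c.J z v a + c.Γ z v (c.J z a) = c.J z (c.Γ z v a))
    (htor : ∀ a b, c.Γ z a b - c.Γ z b a
      + (c.Γ z (c.J z a) (c.J z b) - c.Γ z (c.J z b) (c.J z a)) = 0) (a b : E) :
    (2 : ℝ) • c.mixed z a b = c.Γ z a b + c.J z (c.Γ z (c.J z a) b) := by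
  have hp (v w : E) : fderiv ℝ c.J z v w = c.J z (c.Γ z v w) - c.Γ z v (c.J z w) :=
    eq_sub_of_add_eq (hpar v w)
  have t1 := htor a b
  have t2 := congrArg (c.J z) (htor a (c.J z b))
  simp only [mixed, hp, hJ, map_neg, map_sub, map_add, neg_apply, map_zero] at t2 ⊢
  linear_combination (norm := module) (-1 / 2 : ℝ) • t1 + (1 / 2 : ℝ) • t2

/-- The `(0,1)`-part of `Γ` in its first argument is `mixed`, which depends on `J` alone. Metric
compatibility moves the complementary part onto `d`, where it is again expressed by `mixed`. The
right side contains no `Γ`, so regularity of `G` and `J` passes to `Γ`. -/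
theorem koszul_formula (hJ : ∀ a, c.J z (c.J z a) = -a) (hGJ : ∀ a b, c.G z (c.J z a) (c.J z b) =
    c.G z a b)
    (hmet : ∀ v a b, fderiv ℝ c.G z v a b = c.G z (c.Γ z v a) b + c.G z a (c.Γ z v b))
    (hpar : ∀ v a, fderiv ℝ c.J z v a + c.Γ z v (c.J z a) = c.J z (c.Γ z v a))
    (htor : ∀ a b, c.Γ z a b - c.Γ z b a
      + (c.Γ z (c.J z a) (c.J z b) - c.Γ z (c.J z b) (c.J z a)) = 0) (a b d : E) :
    c.G z (c.Γ z a b) d = (1 / 2) * (fderiv ℝ c.G z a b d + fderiv ℝ c.G z (c.J z a) b (c.J z d)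
      + c.G z b (fderiv ℝ c.J z (c.J z a) d)) + c.G z (c.mixed z a b) d
      - c.G z b (c.mixed z a d) := by
  have hp (v w : E) : fderiv ℝ c.J z v w = c.J z (c.Γ z v w) - c.Γ z v (c.J z w) :=
    eq_sub_of_add_eq (hpar v w)
  have m1 := congrArg (fun w ↦ c.G z w d) (two_smul_mixed hJ hpar htor a b)
  have m2 := congrArg (c.G z b) (two_smul_mixed hJ hpar htor a d)
  have g1 : c.G z (c.J z (c.Γ z (c.J z a) b)) d = - c.G z (c.Γ z (c.J z a) b) (c.J z d) := by
    rw [← hGJ, hJ]; simp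
  simp only [map_smul, smul_apply, map_add, add_apply, smul_eq_mul] at m1 m2
  rw [hmet, hmet, hp, map_sub]
  linear_combination (-1 / 2) * m1 + (1 / 2) * m2 - (1 / 2) * g1

variable [FiniteDimensional ℝ E]

/-- The Christoffel symbols are smooth if `G` and `J` are. -/
theorem contDiffOn_Γ_of_koszul {U : Set E} (hU : IsOpen U) (hG : ContDiffOn ℝ ∞ c.G U)
    (hJs : ContDiffOn ℝ ∞ c.J U) (hpos : ∀ z ∈ U, ∀ a, c.G z a a = 0 → a = 0)
    (hkos : ∀ z ∈ U, ∀ a b d, c.G z (c.Γ z a b) d =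
      (1 / 2) * (fderiv ℝ c.G z a b d + fderiv ℝ c.G z (c.J z a) b (c.J z d)
      + c.G z b (fderiv ℝ c.J z (c.J z a) d)) + c.G z (c.mixed z a b) d
      - c.G z b (c.mixed z a d)) :
    ContDiffOn ℝ ∞ c.Γ U := by
  have := FiniteDimensional.complete ℝ E
  have hdG : ContDiffOn ℝ ∞ (fderiv ℝ c.G) U := hG.fderiv_of_isOpen hU (by simp)
  have hdJ : ContDiffOn ℝ ∞ (fderiv ℝ c.J) U := hJs.fderiv_of_isOpen hU (by simp)
  have hJc (a : E) : ContDiffOn ℝ ∞ (fun z ↦ c.J z a) U := hJs.clm_apply contDiffOn_const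
  have hmix (a b : E) : ContDiffOn ℝ ∞ (fun z ↦ c.mixed z a b) U :=
    contDiffOn_const.smul (((((hdJ.clm_apply (hJc a)).clm_apply contDiffOn_const).sub
      ((hdJ.clm_apply (hJc b)).clm_apply contDiffOn_const)).sub
      (hJs.clm_apply ((hdJ.clm_apply contDiffOn_const).clm_apply contDiffOn_const))).sub
      (hJs.clm_apply ((hdJ.clm_apply contDiffOn_const).clm_apply contDiffOn_const)))
  have hlow (a b : E) : ContDiffOn ℝ ∞ (fun z ↦ c.G z (c.Γ z a b)) U := by
    rw [contDiffOn_clm_apply]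
    intro d
    refine ContDiffOn.congr ?_ fun z hz ↦ hkos z hz a b d
    exact ((contDiffOn_const.mul ((((hdG.clm_apply contDiffOn_const).clm_apply
      contDiffOn_const).clm_apply contDiffOn_const).add
      (((hdG.clm_apply (hJc a)).clm_apply contDiffOn_const).clm_apply (hJc d)) |>.add
      ((hG.clm_apply contDiffOn_const).clm_apply
        ((hdJ.clm_apply (hJc a)).clm_apply contDiffOn_const)))).add
      ((hG.clm_apply (hmix a b)).clm_apply contDiffOn_const)).sub
      ((hG.clm_apply contDiffOn_const).clm_apply (hmix a d))
  have hinv (z) (hz : z ∈ U) : (c.G z).IsInvertible := by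
    have hinj : Function.Injective (c.G z) := by
      rw [injective_iff_map_eq_zero]
      intro a ha
      exact hpos z hz a (by simp [ha])
    have hdim : Module.finrank ℝ E = Module.finrank ℝ (E →L[ℝ] ℝ) := by
      rw [← (LinearMap.toContinuousLinearMap : (E →ₗ[ℝ] ℝ) ≃ₗ[ℝ] _).finrank_eq]
      exact (Subspace.dual_finrank_eq).symm
    refine ⟨(LinearEquiv.ofInjectiveOfFinrankEq (c.G z : E →ₗ[ℝ] E →L[ℝ] ℝ) hinj
      hdim).toContinuousLinearEquiv, ?_⟩
    ext a b
    rfl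
  rw [contDiffOn_clm_apply]
  intro a
  rw [contDiffOn_clm_apply]
  intro b z hz
  -- Raising the index: inversion of continuous linear maps is smooth at the invertible `G z`.
  have e : Set.EqOn (fun z ↦ c.Γ z a b) (fun z ↦ (c.G z).inverse (c.G z (c.Γ z a b))) U :=
    fun y hy ↦ by
      obtain ⟨L, hL⟩ := hinv y hy
      simp [← hL]
  refine ContDiffWithinAt.congr ?_ e (e hz)
  refine ContDiffWithinAt.clm_apply ?_ (hlow a b z hz)
  exact ContDiffAt.comp_contDiffWithinAt z (hinv z hz).contDiffAt_map_inverse (hG z hz)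

end Koszul
end LocalHermitianData

/-! ### Christoffel symbols of a covariant derivative -/

namespace AlmostHermitianStructure

section LocalData

set_option maxSynthPendingDepth 3

variable {E : Type*} [NormedAddCommGroup E] [NormedSpace ℝ E] [FiniteDimensional ℝ E]
  {M : Type*} [TopologicalSpace M] [ChartedSpace E M] [IsManifold 𝓘(ℝ, E) ∞ M]

/-- The Christoffel symbols of a connection in the chart at `p`. -/
noncomputable def christoffel
    (D : CovariantDerivative 𝓘(ℝ, E) E (TangentSpace 𝓘(ℝ, E) : M → Type _)) (p : M) (z : E) :
    E →L[ℝ] E →L[ℝ] E :=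
  (LinearMap.toContinuousLinearMap ((Module.finBasis ℝ E).constr ℝ fun i ↦
    toCoord p ((extChartAt 𝓘(ℝ, E) p).symm z) ∘L
      D (chartSection p fun _ ↦ Module.finBasis ℝ E i) ((extChartAt 𝓘(ℝ, E) p).symm z) ∘L
      ofCoord p ((extChartAt 𝓘(ℝ, E) p).symm z))).flip

variable {p y : M}

theorem ofCoord_christoffel (D : CovariantDerivative 𝓘(ℝ, E) E (TangentSpace 𝓘(ℝ, E) : M → Type _))
    (hy : y ∈ (chartAt E p).source) (v : TangentSpace 𝓘(ℝ, E) y) (w : E) :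
    ofCoord p y (christoffel D p (extChartAt 𝓘(ℝ, E) p y) (toCoord p y v) w) =
      ∑ i, (Module.finBasis ℝ E).repr w i •
        D (chartSection p fun _ ↦ Module.finBasis ℝ E i) y v := by
  rw [christoffel, chart_left_inv hy]
  simp [Module.Basis.constr_apply_fintype, ofCoord_toCoord hy]

/-- Expand `s` in a basis of `E` and apply the Leibniz rule to each term; differentiability of `s`
at the one point is enough. -/
theorem covariantDerivative_chartSection
    (D : CovariantDerivative 𝓘(ℝ, E) E (TangentSpace 𝓘(ℝ, E) : M → Type _))
    (hy : y ∈ (chartAt E p).source) {s : E → E}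
    (hs : DifferentiableAt ℝ s (extChartAt 𝓘(ℝ, E) p y)) (v : TangentSpace 𝓘(ℝ, E) y) :
    D (chartSection p s) y v =
      ofCoord p y (fderiv ℝ s (extChartAt 𝓘(ℝ, E) p y) (toCoord p y v)
        + christoffel D p (extChartAt 𝓘(ℝ, E) p y) (toCoord p y v)
          (s (extChartAt 𝓘(ℝ, E) p y))) := by
  set b := Module.finBasis ℝ E
  set φ := extChartAt 𝓘(ℝ, E) p
  let σ (i : Fin (Module.finrank ℝ E)) : ∀ y : M, TangentSpace 𝓘(ℝ, E) y :=
    chartSection p fun _ ↦ b i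
  let g (i : Fin (Module.finrank ℝ E)) : M → ℝ := fun x ↦ b.repr (s (φ x)) i
  let ℓ (i : Fin (Module.finrank ℝ E)) : E →L[ℝ] ℝ := LinearMap.toContinuousLinearMap (b.coord i)
  have hσ (i) : MDiffAt (T% (σ i)) y := mdifferentiableAt_chartSection hy (differentiableAt_const _)
  have hφ : MDiffAt φ y := mdifferentiableAt_extChartAt hy
  have hg' (i) : DifferentiableAt ℝ (fun z ↦ ℓ i (s z)) (φ y) :=
    (ℓ i).differentiableAt.comp _ hs
  have hg (i) : MDiffAt (g i) y :=
    MDifferentiableAt.comp y (hg' i).mdifferentiableAt hφ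
  have hdg (i) : mvfderiv 𝓘(ℝ, E) (g i) y v = b.repr (fderiv ℝ s (φ y) (toCoord p y v)) i := by
    rw [mvfderiv_eq_fderiv hy (hg i)]
    have e : g i ∘ φ.symm =ᶠ[nhds (φ y)] fun z ↦ ℓ i (s z) := by
      filter_upwards [(isOpen_extChartAt_target p).mem_nhds (extChartAt_mem_target hy)] with z hz
      change b.repr (s (φ (φ.symm z))) i = b.repr (s z) i
      rw [φ.right_inv hz]
    rw [e.fderiv_eq]
    have := ((ℓ i).hasFDerivAt.comp (φ y) hs.hasFDerivAt).fderiv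
    simp only [Function.comp_def] at this
    rw [this]
    rfl
  have hsum : chartSection p s = ∑ i, g i • σ i := by
    funext x
    simp only [Finset.sum_apply, Pi.smul_apply', σ, chartSection, g, ← map_smul, ← map_sum]
    rw [b.sum_repr]
  have hD (t : Finset (Fin (Module.finrank ℝ E))) :
      MDiffAt (T% (∑ i ∈ t, g i • σ i)) y ∧ D (∑ i ∈ t, g i • σ i) y v =
        ∑ i ∈ t, (g i y • D (σ i) y v + mvfderiv 𝓘(ℝ, E) (g i) y v • σ i y) := by
    classical
    induction t using Finset.induction_on with
    | empty =>
      refine ⟨mdifferentiableAt_zeroSection .., ?_⟩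
      simp
    | insert i t hi ih =>
      rw [Finset.sum_insert hi, Finset.sum_insert hi]
      have h1 := (hg i).smul_section (hσ i)
      refine ⟨mdifferentiableAt_add_section h1 ih.1, ?_⟩
      rw [D.isCovariantDerivativeOnUniv.add h1 ih.1, add_apply, ih.2,
        D.isCovariantDerivativeOnUniv.leibniz (hσ i) (hg i)]
      simp
  rw [hsum, (hD _).2, map_add, ofCoord_christoffel D hy, Finset.sum_add_distrib, add_comm]
  congr 1
  simp only [hdg, σ, chartSection, ← map_smul, ← map_sum]
  rw [b.sum_repr]

variable [RiemannianBundle (fun x : M ↦ TangentSpace 𝓘(ℝ, E) x)]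
  [IsContMDiffRiemannianBundle 𝓘(ℝ, E) ∞ E (fun x : M ↦ TangentSpace 𝓘(ℝ, E) x)]
variable (S : AlmostHermitianStructure E M)

/-- The almost Hermitian structure and its canonical connection in the chart at `p`. -/
noncomputable def localData (p : M) : LocalHermitianData E where
  G z := (innerSL ℝ (E := TangentSpace 𝓘(ℝ, E) ((extChartAt 𝓘(ℝ, E) p).symm z))).bilinearComp
    (ofCoord p ((extChartAt 𝓘(ℝ, E) p).symm z)) (ofCoord p ((extChartAt 𝓘(ℝ, E) p).symm z))
  J z := toCoord p ((extChartAt 𝓘(ℝ, E) p).symm z) ∘L S.J ((extChartAt 𝓘(ℝ, E) p).symm z) ∘L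
    ofCoord p ((extChartAt 𝓘(ℝ, E) p).symm z)
  Γ := christoffel S.canonicalConnection p

end LocalData
end AlmostHermitianStructure

/-! ### The canonical connection in a chart satisfies the local axioms -/

namespace AlmostHermitianStructure

section LocalHermitian

set_option maxSynthPendingDepth 3

variable {E : Type*} [NormedAddCommGroup E] [NormedSpace ℝ E]
  {M : Type*} [TopologicalSpace M] [ChartedSpace E M] [IsManifold 𝓘(ℝ, E) ∞ M]
  {p y : M} {z : E}

theorem toCoord_apply (hy : y ∈ (chartAt E p).source) (v : TangentSpace 𝓘(ℝ, E) y) :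
    toCoord p y v = (trivializationAt E (TangentSpace 𝓘(ℝ, E)) p ⟨y, v⟩).2 := by
  rw [toCoord, Bundle.Trivialization.continuousLinearMapAt_apply,
    Bundle.Trivialization.linearMapAt_apply, if_pos (by simpa using hy)]

theorem contDiffAt_toCoord_of_contMDiffAt (hz : z ∈ (extChartAt 𝓘(ℝ, E) p).target)
    {X : ∀ y : M, TangentSpace 𝓘(ℝ, E) y}
    (hX : ContMDiffAt 𝓘(ℝ, E) (𝓘(ℝ, E).prod 𝓘(ℝ, E)) ∞ (T% X) ((extChartAt 𝓘(ℝ, E) p).symm z)) :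
    ContDiffAt ℝ ∞ (fun z ↦ toCoord p ((extChartAt 𝓘(ℝ, E) p).symm z)
      (X ((extChartAt 𝓘(ℝ, E) p).symm z))) z := by
  have : IsManifold 𝓘(ℝ, E) (∞ + 1) M := by simpa
  have hy := extChartAt_symm_mem hz
  rw [(trivializationAt E (TangentSpace 𝓘(ℝ, E)) p).contMDiffAt_section_iff (by simpa using hy)]
    at hX
  have h := (hX.comp z (contMDiffAt_extChartAt_symm hz)).contDiffAt
  refine h.congr_of_eventuallyEq ?_
  filter_upwards [(isOpen_extChartAt_target p).mem_nhds hz] with x hx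
  exact toCoord_apply (extChartAt_symm_mem hx) _

variable [FiniteDimensional ℝ E]

omit [FiniteDimensional ℝ E] in
theorem covariantDerivative_congr
    (D : CovariantDerivative 𝓘(ℝ, E) E (TangentSpace 𝓘(ℝ, E) : M → Type _))
    {X Y : ∀ y : M, TangentSpace 𝓘(ℝ, E) y} (hY : MDiffAt (T% Y) y) (h : X =ᶠ[nhds y] Y) :
    D X y = D Y y := by
  have hX : MDiffAt (T% X) y := by
    refine hY.congr_of_eventuallyEq ?_
    filter_upwards [h] with x hx
    rw [hx]
  exact D.isCovariantDerivativeOnUniv.congr_of_eventuallyEq hX hY Filter.univ_mem h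

theorem covariantDerivative_chartSection_symm
    (D : CovariantDerivative 𝓘(ℝ, E) E (TangentSpace 𝓘(ℝ, E) : M → Type _))
    (hz : z ∈ (extChartAt 𝓘(ℝ, E) p).target) {s : E → E} (hs : DifferentiableAt ℝ s z) (v : E) :
    D (chartSection p s) ((extChartAt 𝓘(ℝ, E) p).symm z)
      (ofCoord p ((extChartAt 𝓘(ℝ, E) p).symm z) v) =
      ofCoord p ((extChartAt 𝓘(ℝ, E) p).symm z) (fderiv ℝ s z v + christoffel D p z v (s z)) := by
  have hr := (extChartAt 𝓘(ℝ, E) p).right_inv hz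
  have hy := extChartAt_symm_mem hz
  rw [covariantDerivative_chartSection D hy (by rwa [hr]), toCoord_ofCoord hy, hr]

theorem torsion_ofCoord (D : CovariantDerivative 𝓘(ℝ, E) E (TangentSpace 𝓘(ℝ, E) : M → Type _))
    [CompleteSpace E] (hz : z ∈ (extChartAt 𝓘(ℝ, E) p).target) (a b : E) :
    D.torsion ((extChartAt 𝓘(ℝ, E) p).symm z) (ofCoord p ((extChartAt 𝓘(ℝ, E) p).symm z) a)
      (ofCoord p ((extChartAt 𝓘(ℝ, E) p).symm z) b) =
      ofCoord p ((extChartAt 𝓘(ℝ, E) p).symm z)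
        (christoffel D p z a b - christoffel D p z b a) := by
  have hy := extChartAt_symm_mem hz
  have h := D.torsion_apply
    (mdifferentiableAt_chartSection (s := fun _ ↦ a) hy (differentiableAt_const a))
    (mdifferentiableAt_chartSection (s := fun _ ↦ b) hy (differentiableAt_const b))
  rw [mlieBracket_chartSection_const hy, sub_zero] at h
  refine h.trans ?_
  have e1 := covariantDerivative_chartSection_symm D hz (differentiableAt_const b) a
  have e2 := covariantDerivative_chartSection_symm D hz (differentiableAt_const a) b
  simp only [fderiv_fun_const, Pi.zero_apply, zero_apply, zero_add] at e1 e2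
  rw [map_sub, ← e1, ← e2]
  rfl

variable [RiemannianBundle (fun x : M ↦ TangentSpace 𝓘(ℝ, E) x)]
  [IsContMDiffRiemannianBundle 𝓘(ℝ, E) ∞ E (fun x : M ↦ TangentSpace 𝓘(ℝ, E) x)]
variable (S : AlmostHermitianStructure E M)

theorem localData_G_apply (a b : E) :
    (S.localData p).G z a b = inner ℝ (ofCoord p ((extChartAt 𝓘(ℝ, E) p).symm z) a)
      (ofCoord p ((extChartAt 𝓘(ℝ, E) p).symm z) b) := rfl

theorem localData_J_apply (a : E) :
    (S.localData p).J z a = toCoord p ((extChartAt 𝓘(ℝ, E) p).symm z)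
      (S.J ((extChartAt 𝓘(ℝ, E) p).symm z) (ofCoord p ((extChartAt 𝓘(ℝ, E) p).symm z) a)) := rfl

theorem ofCoord_localData_J (hz : z ∈ (extChartAt 𝓘(ℝ, E) p).target) (a : E) :
    ofCoord p ((extChartAt 𝓘(ℝ, E) p).symm z) ((S.localData p).J z a) =
      S.J ((extChartAt 𝓘(ℝ, E) p).symm z) (ofCoord p ((extChartAt 𝓘(ℝ, E) p).symm z) a) := by
  rw [localData_J_apply, ofCoord_toCoord (extChartAt_symm_mem hz)]

theorem contDiffOn_localData_G :
    ContDiffOn ℝ ∞ (S.localData p).G (extChartAt 𝓘(ℝ, E) p).target := by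
  rw [contDiffOn_clm_apply]
  intro a
  rw [contDiffOn_clm_apply]
  intro b z hz
  refine ContDiffAt.contDiffWithinAt ?_
  have hy := extChartAt_symm_mem hz
  have h : ContMDiffAt 𝓘(ℝ, E) 𝓘(ℝ, ℝ) ∞ (ip (chartSection p fun _ ↦ a) (chartSection p fun _ ↦ b))
      ((extChartAt 𝓘(ℝ, E) p).symm z) :=
    ContMDiffAt.inner_bundle (IB := 𝓘(ℝ, E)) (F := E) (contMDiffAt_chartSection hy contDiffAt_const)
      (contMDiffAt_chartSection hy contDiffAt_const)
  exact (h.comp z (contMDiffAt_extChartAt_symm hz)).contDiffAt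

omit [FiniteDimensional ℝ E]
  [IsContMDiffRiemannianBundle 𝓘(ℝ, E) ∞ E (fun x : M ↦ TangentSpace 𝓘(ℝ, E) x)] in
theorem contMDiffAt_applyJ {X : ∀ y : M, TangentSpace 𝓘(ℝ, E) y}
    (hX : ContMDiffAt 𝓘(ℝ, E) (𝓘(ℝ, E).prod 𝓘(ℝ, E)) ∞ (T% X) y) :
    ContMDiffAt 𝓘(ℝ, E) (𝓘(ℝ, E).prod 𝓘(ℝ, E)) ∞ (T% (S.applyJ X)) y :=
  ContMDiffAt.clm_bundle_apply (F₁ := E) (F₂ := E) (S.contMDiff_J y) hX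

theorem contDiffOn_localData_J :
    ContDiffOn ℝ ∞ (S.localData p).J (extChartAt 𝓘(ℝ, E) p).target := by
  rw [contDiffOn_clm_apply]
  intro a z hz
  refine ContDiffAt.contDiffWithinAt ?_
  exact contDiffAt_toCoord_of_contMDiffAt hz (S.contMDiffAt_applyJ
    (contMDiffAt_chartSection (s := fun _ ↦ a) (extChartAt_symm_mem hz) contDiffAt_const))

theorem applyJ_chartSection_eventuallyEq (hy : y ∈ (chartAt E p).source) (a : E) :
    S.applyJ (chartSection p fun _ ↦ a) =ᶠ[nhds y]
      chartSection p fun z ↦ (S.localData p).J z a := by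
  filter_upwards [(chartAt E p).open_source.mem_nhds hy] with x hx
  exact (chartSection_toCoord hx (S.applyJ (chartSection p fun _ ↦ a))).symm

theorem isHermitianOn_localData (p : M) :
    (S.localData p).IsHermitianOn (extChartAt 𝓘(ℝ, E) p).target := by
  have hc := FiniteDimensional.complete ℝ E
  have hcan := S.isCanonicalConnection_canonicalConnection
  have hopen : IsOpen (extChartAt 𝓘(ℝ, E) p).target := isOpen_extChartAt_target p
  have hinj {z : E} (hz : z ∈ (extChartAt 𝓘(ℝ, E) p).target) {a b : E}
      (h : ofCoord p ((extChartAt 𝓘(ℝ, E) p).symm z) a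
        = ofCoord p ((extChartAt 𝓘(ℝ, E) p).symm z) b) : a = b := by
    rw [← toCoord_ofCoord (extChartAt_symm_mem hz) a, h, toCoord_ofCoord (extChartAt_symm_mem hz)]
  have hG := S.contDiffOn_localData_G (p := p)
  have hJ := S.contDiffOn_localData_J (p := p)
  have hJsq (z) (hz : z ∈ (extChartAt 𝓘(ℝ, E) p).target) (a : E) :
      (S.localData p).J z ((S.localData p).J z a) = -a := by
    apply hinj hz
    rw [S.ofCoord_localData_J hz, S.ofCoord_localData_J hz, S.J_sq, map_neg]
  have hGJ (z) (hz : z ∈ (extChartAt 𝓘(ℝ, E) p).target) (a b : E) :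
      (S.localData p).G z ((S.localData p).J z a) ((S.localData p).J z b)
        = (S.localData p).G z a b := by
    rw [localData_G_apply, S.ofCoord_localData_J hz, S.ofCoord_localData_J hz, S.inner_J]
    rfl
  have hconn (z) (hz : z ∈ (extChartAt 𝓘(ℝ, E) p).target) (v a : E) :
      S.canonicalConnection (chartSection p fun _ ↦ a) ((extChartAt 𝓘(ℝ, E) p).symm z)
      (ofCoord p ((extChartAt 𝓘(ℝ, E) p).symm z) v)
      = ofCoord p ((extChartAt 𝓘(ℝ, E) p).symm z) ((S.localData p).Γ z v a) := by
    have e1 := covariantDerivative_chartSection_symm S.canonicalConnection hz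
      (differentiableAt_const a) v
    simp only [fderiv_fun_const, Pi.zero_apply, zero_apply, zero_add] at e1
    exact e1
  have hmet (z) (hz : z ∈ (extChartAt 𝓘(ℝ, E) p).target) (v a b : E) :
      fderiv ℝ (S.localData p).G z v a b = (S.localData p).G z ((S.localData p).Γ z v a) b
        + (S.localData p).G z a ((S.localData p).Γ z v b) := by
    have hy := extChartAt_symm_mem hz
    have da := mdifferentiableAt_chartSection (s := fun _ ↦ a) hy (differentiableAt_const a)
    have db := mdifferentiableAt_chartSection (s := fun _ ↦ b) hy (differentiableAt_const b)
    have h1 := hcan.metric _ _ _ da db (ofCoord p ((extChartAt 𝓘(ℝ, E) p).symm z) v)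
    change mvfderiv 𝓘(ℝ, E) (ip _ _) _ _ = _ at h1
    rw [mvfderiv_eq_fderiv hy (mdiff_inner da db), toCoord_ofCoord hy,
      (extChartAt 𝓘(ℝ, E) p).right_inv hz, hconn z hz, hconn z hz] at h1
    have h2 := ((((hG.contDiffAt (hopen.mem_nhds hz)).differentiableAt (by
      simp)).hasFDerivAt.clm_apply
      (hasFDerivAt_const a z)).clm_apply (hasFDerivAt_const b z)).fderiv
    have h3 := DFunLike.congr_fun h2 v
    simp at h3
    exact h3.symm.trans h1
  have hpar (z) (hz : z ∈ (extChartAt 𝓘(ℝ, E) p).target) (v a : E) :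
      fderiv ℝ (S.localData p).J z v a + (S.localData p).Γ z v ((S.localData p).J z a) =
        (S.localData p).J z ((S.localData p).Γ z v a) := by
    have hy := extChartAt_symm_mem hz
    have da := mdifferentiableAt_chartSection (s := fun _ ↦ a) hy (differentiableAt_const a)
    have h1 := hcan.parallel _ _ da (ofCoord p ((extChartAt 𝓘(ℝ, E) p).symm z) v)
    have hJd : HasFDerivAt (S.localData p).J (fderiv ℝ (S.localData p).J z) z :=
      ((hJ.contDiffAt (hopen.mem_nhds hz)).differentiableAt (by simp)).hasFDerivAt
    have hJa := hJd.clm_apply (hasFDerivAt_const a z)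
    have hd := mdifferentiableAt_chartSection (p := p) (y := (extChartAt 𝓘(ℝ, E) p).symm z)
      (s := fun z ↦ (S.localData p).J z a) hy
      (by rw [(extChartAt 𝓘(ℝ, E) p).right_inv hz]; exact hJa.differentiableAt)
    have h2 := covariantDerivative_congr S.canonicalConnection hd
      (S.applyJ_chartSection_eventuallyEq hy a)
    change S.canonicalConnection (S.applyJ _) _ _ = _ at h1
    rw [h2, covariantDerivative_chartSection_symm _ hz hJa.differentiableAt, hconn z hz, hJa.fderiv,
      ← S.ofCoord_localData_J hz] at h1
    have h3 := hinj hz h1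
    simp only [ContinuousLinearMap.flip_apply, ContinuousLinearMap.comp_zero,
      zero_add] at h3
    exact h3
  have htor (z) (hz : z ∈ (extChartAt 𝓘(ℝ, E) p).target) (a b : E) :
      (S.localData p).Γ z a b - (S.localData p).Γ z b a
      + ((S.localData p).Γ z ((S.localData p).J z a) ((S.localData p).J z b)
        - (S.localData p).Γ z ((S.localData p).J z b) ((S.localData p).J z a)) = 0 := by
    have h1 := (hcan.torsion ((extChartAt 𝓘(ℝ, E) p).symm z)
      (ofCoord p ((extChartAt 𝓘(ℝ, E) p).symm z) a)
      (ofCoord p ((extChartAt 𝓘(ℝ, E) p).symm z) b)).1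
    rw [← S.ofCoord_localData_J hz, ← S.ofCoord_localData_J hz, torsion_ofCoord _ hz,
      torsion_ofCoord _ hz, ← map_add] at h1
    exact hinj hz (h1.trans (map_zero _).symm)
  exact {
    isOpen := hopen
    contDiffOn_G := hG
    contDiffOn_J := hJ
    -- The connection comes from an existence statement without regularity, so smoothness is
    -- recovered from the identities just verified.
    contDiffOn_Γ := LocalHermitianData.contDiffOn_Γ_of_koszul hopen hG hJ
      (fun z hz a h ↦ by
        rw [localData_G_apply, inner_self_eq_zero] at h
        exact hinj hz (h.trans (map_zero _).symm))
      (fun z hz ↦ LocalHermitianData.koszul_formula (hJsq z hz) (hGJ z hz) (hmet z hz) (hpar z hz)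
        (htor z hz))
    symm := fun z hz a b ↦ by
      rw [localData_G_apply, real_inner_comm, ← localData_G_apply]
    nonneg := fun z hz a ↦ by
      rw [localData_G_apply]; exact real_inner_self_nonneg
    J_sq := hJsq
    G_J := hGJ
    metric := hmet
    parallel := hpar
    torsion_add := htor }

end LocalHermitian
end AlmostHermitianStructure

namespace LocalHermitianData

theorem IsHermitianOn.mono {E : Type*} [NormedAddCommGroup E] [NormedSpace ℝ E]
    {c : LocalHermitianData E} {U V : Set E} (h : c.IsHermitianOn U) (hV : IsOpen V) (hVU : V ⊆ U) :
    c.IsHermitianOn V where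
  isOpen := hV
  contDiffOn_G := h.contDiffOn_G.mono hVU
  contDiffOn_J := h.contDiffOn_J.mono hVU
  contDiffOn_Γ := h.contDiffOn_Γ.mono hVU
  symm z hz := h.symm z (hVU hz)
  nonneg z hz := h.nonneg z (hVU hz)
  J_sq z hz := h.J_sq z (hVU hz)
  G_J z hz := h.G_J z (hVU hz)
  metric z hz := h.metric z (hVU hz)
  parallel z hz := h.parallel z (hVU hz)
  torsion_add z hz := h.torsion_add z (hVU hz)

end LocalHermitianData

/-! ### Curvature and Hessian in a chart -/

namespace AlmostHermitianStructure

section Curvature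

set_option maxSynthPendingDepth 3

variable {E : Type*} [NormedAddCommGroup E] [NormedSpace ℝ E] [FiniteDimensional ℝ E]
  {M : Type*} [TopologicalSpace M] [ChartedSpace E M] [IsManifold 𝓘(ℝ, E) ∞ M]
  [RiemannianBundle (fun x : M ↦ TangentSpace 𝓘(ℝ, E) x)]
  [IsContMDiffRiemannianBundle 𝓘(ℝ, E) ∞ E (fun x : M ↦ TangentSpace 𝓘(ℝ, E) x)]
  (S : AlmostHermitianStructure E M) {p : M}

omit [FiniteDimensional ℝ E] [RiemannianBundle (fun x : M ↦ TangentSpace 𝓘(ℝ, E) x)]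
  [IsContMDiffRiemannianBundle 𝓘(ℝ, E) ∞ E (fun x : M ↦ TangentSpace 𝓘(ℝ, E) x)] in
theorem extend_ofCoord_eventuallyEq (v : E) :
    (FiberBundle.extend E (ofCoord p p v) : ∀ y : M, TangentSpace 𝓘(ℝ, E) y)
      =ᶠ[nhds p] chartSection p (fun _ ↦ v) := by
  filter_upwards [(chartAt E p).open_source.mem_nhds (mem_chart_source E p)] with x hx
  rw [extend_eq_chartSection hx, toCoord_ofCoord (mem_chart_source E p)]

theorem canonicalConnection_extend_ofCoord (b d : E) :
    (fun y ↦ S.canonicalConnection (FiberBundle.extend E (ofCoord p p d)) y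
      (FiberBundle.extend E (ofCoord p p b) y)) =ᶠ[nhds p]
      chartSection p (fun z ↦ (S.localData p).Γ z b d) := by
  filter_upwards [(chartAt E p).open_source.mem_nhds (mem_chart_source E p),
    (extend_ofCoord_eventuallyEq (p := p) d).eventuallyEq_nhds] with y hy hd
  rw [covariantDerivative_congr S.canonicalConnection
    (mdifferentiableAt_chartSection hy (differentiableAt_const d)) hd, extend_eq_chartSection hy,
    toCoord_ofCoord (mem_chart_source E p), covariantDerivative_chartSection _ hy
      (differentiableAt_const d)]
  simp only [fderiv_fun_const, Pi.zero_apply, zero_apply, zero_add, chartSection, toCoord_ofCoord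
    hy]
  rfl

/-- The extended vectors are constant in the chart near `p`, so the bracket term vanishes and only
Christoffel terms remain. -/
theorem curvature_ofCoord (a b d : E) :
    S.curvature p (ofCoord p p a) (ofCoord p p b) (ofCoord p p d) =
      ofCoord p p ((S.localData p).curv (extChartAt 𝓘(ℝ, E) p p) a b d) := by
  have hc := FiniteDimensional.complete ℝ E
  have hp := mem_chart_source E p
  have hΓ : HasFDerivAt (S.localData p).Γ _ (extChartAt 𝓘(ℝ, E) p p) :=
    (S.isHermitianOn_localData p).hasFDerivAt_Γ (extChartAt_mem_target hp)
  have hΓ' (b d : E) := (hΓ.clm_apply (hasFDerivAt_const b _)).clm_apply (hasFDerivAt_const d _)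
  have key (a b d : E) : S.canonicalConnection (fun y ↦ S.canonicalConnection
      (FiberBundle.extend E (ofCoord p p d)) y (FiberBundle.extend E (ofCoord p p b) y)) p
      (FiberBundle.extend E (ofCoord p p a) p) = ofCoord p p
        (fderiv ℝ (S.localData p).Γ (extChartAt 𝓘(ℝ, E) p p) a b d +
        (S.localData p).Γ (extChartAt 𝓘(ℝ, E) p p) a
          ((S.localData p).Γ (extChartAt 𝓘(ℝ, E) p p) b d)) := by
    rw [covariantDerivative_congr _ (mdifferentiableAt_chartSection hp (hΓ' b d).differentiableAt)
      (S.canonicalConnection_extend_ofCoord b d), FiberBundle.extend_apply_self,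
      covariantDerivative_chartSection _ hp (hΓ' b d).differentiableAt, (hΓ' b d).fderiv,
      toCoord_ofCoord hp]
    simp
    rfl
  rw [curvature, curvatureField, key, key,
    (extend_ofCoord_eventuallyEq a).mlieBracket_vectorField_eq (extend_ofCoord_eventuallyEq b),
    mlieBracket_chartSection_const hp, map_zero, sub_zero, ← map_sub, LocalHermitianData.curv]
  congr 1
  abel

theorem localData_G_self (a b : E) : (S.localData p).G (extChartAt 𝓘(ℝ, E) p p) a b =
    inner ℝ (ofCoord p p a) (ofCoord p p b) := by
  rw [localData_G_apply, chart_left_inv (mem_chart_source E p)]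

theorem ofCoord_localData_J_self (a : E) :
    ofCoord p p ((S.localData p).J (extChartAt 𝓘(ℝ, E) p p) a) = S.J p (ofCoord p p a) := by
  have hp := mem_chart_source E p
  have := S.ofCoord_localData_J (extChartAt_mem_target hp) a
  rwa [chart_left_inv hp] at this

theorem localData_G_curv (b : E) :
    (S.localData p).G (extChartAt 𝓘(ℝ, E) p p) ((S.localData p).curv (extChartAt 𝓘(ℝ, E) p p) b
      ((S.localData p).J (extChartAt 𝓘(ℝ, E) p p) b)
      ((S.localData p).J (extChartAt 𝓘(ℝ, E) p p) b)) b =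
      inner ℝ (S.curvature p (ofCoord p p b) (S.J p (ofCoord p p b)) (S.J p (ofCoord p p b)))
        (ofCoord p p b) := by
  rw [localData_G_self, ← curvature_ofCoord, ofCoord_localData_J_self]

theorem le_localData_G_curv {k : ℝ}
    (hM : ∀ v : TangentSpace 𝓘(ℝ, E) p, v ≠ 0 → -k ≤ S.holSecCurvature p v) (b : E) :
    -k * ((S.localData p).G (extChartAt 𝓘(ℝ, E) p p) b b) ^ 2 ≤
    (S.localData p).G (extChartAt 𝓘(ℝ, E) p p) ((S.localData p).curv (extChartAt 𝓘(ℝ, E) p p) b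
      ((S.localData p).J (extChartAt 𝓘(ℝ, E) p p) b)
      ((S.localData p).J (extChartAt 𝓘(ℝ, E) p p) b)) b := by
  rw [localData_G_curv, localData_G_self, real_inner_self_eq_norm_sq, ← pow_mul]
  by_cases hb : ofCoord p p b = 0
  · simp [hb]
  · have h := hM _ hb
    rwa [holSecCurvature, le_div_iff₀ (by positivity)] at h

theorem localData_G_curv_le {k : ℝ}
    (hM : ∀ v : TangentSpace 𝓘(ℝ, E) p, v ≠ 0 → S.holSecCurvature p v ≤ -k) (b : E) :
    (S.localData p).G (extChartAt 𝓘(ℝ, E) p p) ((S.localData p).curv (extChartAt 𝓘(ℝ, E) p p) b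
      ((S.localData p).J (extChartAt 𝓘(ℝ, E) p p) b)
      ((S.localData p).J (extChartAt 𝓘(ℝ, E) p p) b)) b ≤
    -k * ((S.localData p).G (extChartAt 𝓘(ℝ, E) p p) b b) ^ 2 := by
  rw [localData_G_curv, localData_G_self, real_inner_self_eq_norm_sq, ← pow_mul]
  by_cases hb : ofCoord p p b = 0
  · simp [hb]
  · have h := hM _ hb
    rwa [holSecCurvature, div_le_iff₀ (by positivity)] at h

variable {u : M → ℝ}

omit [FiniteDimensional ℝ E] [RiemannianBundle (fun x : M ↦ TangentSpace 𝓘(ℝ, E) x)]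
  [IsContMDiffRiemannianBundle 𝓘(ℝ, E) ∞ E (fun x : M ↦ TangentSpace 𝓘(ℝ, E) x)] in
theorem contDiffAt_comp_extChartAt_symm (hu : ContMDiffAt 𝓘(ℝ, E) 𝓘(ℝ, ℝ) 2 u p) :
    ContDiffAt ℝ 2 (u ∘ (extChartAt 𝓘(ℝ, E) p).symm) (extChartAt 𝓘(ℝ, E) p p) := by
  have hp := mem_chart_source E p
  rw [← contMDiffAt_iff_contDiffAt]
  refine ContMDiffAt.comp _ (by rwa [chart_left_inv hp]) ?_
  exact (contMDiffAt_extChartAt_symm (extChartAt_mem_target hp)).of_le ENat.LEInfty.out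

theorem hessian_ofCoord (hu : ContMDiffAt 𝓘(ℝ, E) 𝓘(ℝ, ℝ) 2 u p) (a b : E) :
    S.hessian u p (ofCoord p p a) (ofCoord p p b) =
      fderiv ℝ (fderiv ℝ (u ∘ (extChartAt 𝓘(ℝ, E) p).symm)) (extChartAt 𝓘(ℝ, E) p p) b a
      - fderiv ℝ (u ∘ (extChartAt 𝓘(ℝ, E) p).symm) (extChartAt 𝓘(ℝ, E) p p)
        ((S.localData p).Γ (extChartAt 𝓘(ℝ, E) p p) b a) := by
  have hp := mem_chart_source E p
  have hu' := contDiffAt_comp_extChartAt_symm hu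
  have hd := hu'.hasFDerivAt_fderiv_of_two.clm_apply (hasFDerivAt_const a _)
  have e1 : (fun y ↦ mvfderiv 𝓘(ℝ, E) u y (FiberBundle.extend E (ofCoord p p a) y)) =ᶠ[nhds p]
      (fun z ↦ fderiv ℝ (u ∘ (extChartAt 𝓘(ℝ, E) p).symm) z a) ∘ extChartAt 𝓘(ℝ, E) p := by
    filter_upwards [(chartAt E p).open_source.mem_nhds hp,
      (contMDiffAt_iff_contMDiffAt_nhds (by simp)).1 hu] with y hy huy
    rw [mvfderiv_eq_fderiv hy (huy.mdifferentiableAt (by simp)), extend_eq_chartSection hy,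
      toCoord_ofCoord hp, chartSection, toCoord_ofCoord hy]
    rfl
  have hm : MDiffAt ((fun z ↦ fderiv ℝ (u ∘ (extChartAt 𝓘(ℝ, E) p).symm) z a) ∘
      extChartAt 𝓘(ℝ, E) p) p :=
    MDifferentiableAt.comp p hd.differentiableAt.mdifferentiableAt (mdifferentiableAt_extChartAt hp)
  have e2 : ((fun z ↦ fderiv ℝ (u ∘ (extChartAt 𝓘(ℝ, E) p).symm) z a) ∘
      extChartAt 𝓘(ℝ, E) p) ∘ (extChartAt 𝓘(ℝ, E) p).symm =ᶠ[nhds (extChartAt 𝓘(ℝ, E) p p)]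
      fun z ↦ fderiv ℝ (u ∘ (extChartAt 𝓘(ℝ, E) p).symm) z a := by
    filter_upwards [(isOpen_extChartAt_target p).mem_nhds (extChartAt_mem_target hp)] with z hz
    simp only [Function.comp_apply, (extChartAt 𝓘(ℝ, E) p).right_inv hz]
  have e3 := S.canonicalConnection_extend_ofCoord (p := p) b a |>.self_of_nhds
  dsimp only at e3
  rw [FiberBundle.extend_apply_self] at e3
  rw [hessian, e3, chartSection, mvfderiv_eq_fderiv hp (hu.mdifferentiableAt (by simp)),
    toCoord_ofCoord hp]
  congr 1
  have e4 : mvfderiv 𝓘(ℝ, E) (fun y ↦ mvfderiv 𝓘(ℝ, E) u y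
      (FiberBundle.extend E (ofCoord p p a) y)) p = mvfderiv 𝓘(ℝ, E)
      ((fun z ↦ fderiv ℝ (u ∘ (extChartAt 𝓘(ℝ, E) p).symm) z a) ∘ extChartAt 𝓘(ℝ, E) p) p :=
    e1.mfderiv_eq
  rw [e4, mvfderiv_eq_fderiv hp hm, e2.fderiv_eq, hd.fderiv, toCoord_ofCoord hp]
  simp

theorem leviForm_ofCoord (hu : ContMDiffAt 𝓘(ℝ, E) 𝓘(ℝ, ℝ) 2 u p) (a : E) :
    S.leviForm u p (ofCoord p p a) =
      (S.localData p).levi (u ∘ (extChartAt 𝓘(ℝ, E) p).symm) (extChartAt 𝓘(ℝ, E) p p) a := by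
  rw [leviForm, ← ofCoord_localData_J_self, S.hessian_ofCoord hu, S.hessian_ofCoord hu,
    LocalHermitianData.levi]

end Curvature

/-! ### Almost holomorphic maps in charts -/

section Maps

set_option maxSynthPendingDepth 3

variable {E : Type*} [NormedAddCommGroup E] [NormedSpace ℝ E]
  {M : Type*} [TopologicalSpace M] [ChartedSpace E M] [IsManifold 𝓘(ℝ, E) ∞ M]
  {F : Type*} [NormedAddCommGroup F] [NormedSpace ℝ F]
  {N : Type*} [TopologicalSpace N] [ChartedSpace F N] [IsManifold 𝓘(ℝ, F) ∞ N]

/-- The domain of a map written in the charts at `p` and `q`. -/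
def chartDomain (E F : Type*) [NormedAddCommGroup E] [NormedSpace ℝ E] [NormedAddCommGroup F]
    [NormedSpace ℝ F] {M N : Type*} [TopologicalSpace M] [ChartedSpace E M] [TopologicalSpace N]
    [ChartedSpace F N] (f : M → N) (p : M) (q : N) : Set E :=
  (extChartAt 𝓘(ℝ, E) p).target ∩ (extChartAt 𝓘(ℝ, E) p).symm ⁻¹' (f ⁻¹' (chartAt F q).source)

/-- A map written in the charts at `p` and `q`. -/
noncomputable def inCharts (E F : Type*) [NormedAddCommGroup E] [NormedSpace ℝ E]
    [NormedAddCommGroup F] [NormedSpace ℝ F] {M N : Type*} [TopologicalSpace M] [ChartedSpace E M]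
    [TopologicalSpace N] [ChartedSpace F N] (f : M → N) (p : M) (q : N) (z : E) : F :=
  extChartAt 𝓘(ℝ, F) q (f ((extChartAt 𝓘(ℝ, E) p).symm z))

variable {f : M → N} {p : M} {q : N} {z : E}

omit [IsManifold 𝓘(ℝ, E) ∞ M] [IsManifold 𝓘(ℝ, F) ∞ N] in
theorem isOpen_chartDomain (hf : Continuous f) : IsOpen (chartDomain E F f p q) :=
  (continuousOn_extChartAt_symm p).isOpen_inter_preimage (isOpen_extChartAt_target p)
    ((chartAt F q).open_source.preimage hf)

theorem contDiffOn_inCharts (hf : ContMDiff 𝓘(ℝ, E) 𝓘(ℝ, F) ∞ f) :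
    ContDiffOn ℝ ∞ (inCharts E F f p q) (chartDomain E F f p q) := by
  intro z hz
  refine ContDiffAt.contDiffWithinAt ?_
  rw [← contMDiffAt_iff_contDiffAt]
  exact (contMDiffAt_extChartAt' (I := 𝓘(ℝ, F)) hz.2).comp z
    ((hf _).comp z (contMDiffAt_extChartAt_symm hz.1))

theorem fderiv_inCharts (hf : ContMDiff 𝓘(ℝ, E) 𝓘(ℝ, F) ∞ f) (hz : z ∈ chartDomain E F f p q)
    (a : E) :
    fderiv ℝ (inCharts E F f p q) z a = toCoord q (f ((extChartAt 𝓘(ℝ, E) p).symm z))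
      (mfderiv 𝓘(ℝ, E) 𝓘(ℝ, F) f ((extChartAt 𝓘(ℝ, E) p).symm z)
        (ofCoord p ((extChartAt 𝓘(ℝ, E) p).symm z) a)) := by
  have hy := extChartAt_symm_mem hz.1
  have hfd : MDifferentiableAt 𝓘(ℝ, E) 𝓘(ℝ, F) f ((extChartAt 𝓘(ℝ, E) p).symm z) :=
    (hf _).mdifferentiableAt (by simp)
  have hq : MDifferentiableAt 𝓘(ℝ, F) 𝓘(ℝ, F) (extChartAt 𝓘(ℝ, F) q)
    (f ((extChartAt 𝓘(ℝ, E) p).symm z)) := mdifferentiableAt_extChartAt hz.2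
  have h := mvfderiv_eq_fderiv hy (hq.comp _ hfd) (ofCoord p ((extChartAt 𝓘(ℝ, E) p).symm z) a)
  rw [toCoord_ofCoord hy, (extChartAt 𝓘(ℝ, E) p).right_inv hz.1] at h
  rw [toCoord_eq_mfderiv hz.2]
  refine h.symm.trans ?_
  exact mfderiv_comp_apply _ hq hfd _

variable [FiniteDimensional ℝ E] [FiniteDimensional ℝ F]
  [RiemannianBundle (fun x : M ↦ TangentSpace 𝓘(ℝ, E) x)]
  [IsContMDiffRiemannianBundle 𝓘(ℝ, E) ∞ E (fun x : M ↦ TangentSpace 𝓘(ℝ, E) x)]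
  [RiemannianBundle (fun y : N ↦ TangentSpace 𝓘(ℝ, F) y)]
  [IsContMDiffRiemannianBundle 𝓘(ℝ, F) ∞ F (fun y : N ↦ TangentSpace 𝓘(ℝ, F) y)]
  {S : AlmostHermitianStructure E M} {S' : AlmostHermitianStructure F N}

omit [FiniteDimensional ℝ E] [RiemannianBundle (fun x : M ↦ TangentSpace 𝓘(ℝ, E) x)]
  [IsContMDiffRiemannianBundle 𝓘(ℝ, E) ∞ E (fun x : M ↦ TangentSpace 𝓘(ℝ, E) x)] in
theorem localData_G_inCharts (hf : ContMDiff 𝓘(ℝ, E) 𝓘(ℝ, F) ∞ f)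
    (hz : z ∈ chartDomain E F f p q) (a b : E) :
    (S'.localData q).G (inCharts E F f p q z) (fderiv ℝ (inCharts E F f p q) z a)
      (fderiv ℝ (inCharts E F f p q) z b) =
    inner ℝ (mfderiv 𝓘(ℝ, E) 𝓘(ℝ, F) f ((extChartAt 𝓘(ℝ, E) p).symm z)
        (ofCoord p ((extChartAt 𝓘(ℝ, E) p).symm z) a))
      (mfderiv 𝓘(ℝ, E) 𝓘(ℝ, F) f ((extChartAt 𝓘(ℝ, E) p).symm z)
        (ofCoord p ((extChartAt 𝓘(ℝ, E) p).symm z) b)) := by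
  rw [localData_G_apply, fderiv_inCharts hf hz, fderiv_inCharts hf hz, inCharts,
    chart_left_inv hz.2, ofCoord_toCoord hz.2, ofCoord_toCoord hz.2]

theorem isHolomorphicOn_inCharts (hf : IsAlmostHolomorphic S S' f) :
    (S.localData p).IsHolomorphicOn (S'.localData q) (chartDomain E F f p q)
      (extChartAt 𝓘(ℝ, F) q).target (inCharts E F f p q) where
  mapsTo _ hz := extChartAt_mem_target hz.2
  contDiffOn := contDiffOn_inCharts hf.contMDiff
  fderiv_J z hz v := by
    rw [fderiv_inCharts hf.contMDiff hz, fderiv_inCharts hf.contMDiff hz, S.ofCoord_localData_J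
      hz.1,
      hf.mfderiv_J, localData_J_apply, inCharts, chart_left_inv hz.2, ofCoord_toCoord hz.2]

end Maps
end AlmostHermitianStructure

/-! ### The Levi form of the cutoff function -/

namespace LocalHermitianData

section Levi

set_option maxSynthPendingDepth 3

variable {E : Type*} [NormedAddCommGroup E] [NormedSpace ℝ E] {w : E → ℝ} {z : E}

theorem fderiv_one_sub_mul_sq (hw : DifferentiableAt ℝ w z) (r : ℝ) :
    fderiv ℝ (fun y ↦ (1 - r * w y) ^ 2) z = (-2 * r * (1 - r * w z)) • fderiv ℝ w z := by
  have h := ((hw.hasFDerivAt.const_mul r).const_sub 1).pow 2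
  rw [h.fderiv]
  ext a
  simp
  ring

theorem levi_one_sub_mul_sq (c : LocalHermitianData E) (hw : ContDiffAt ℝ 2 w z) (r : ℝ) (a : E) :
    c.levi (fun y ↦ (1 - r * w y) ^ 2) z a =
      2 * r ^ 2 * ((fderiv ℝ w z a) ^ 2 + (fderiv ℝ w z (c.J z a)) ^ 2)
        - 2 * r * (1 - r * w z) * c.levi w z a := by
  have h1 : fderiv ℝ (fun y ↦ (1 - r * w y) ^ 2) =ᶠ[nhds z]
      fun y ↦ (-2 * r * (1 - r * w y)) • fderiv ℝ w y := by
    filter_upwards [hw.eventually (by simp)] with y hy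
    exact fderiv_one_sub_mul_sq (hy.differentiableAt (by simp)) r
  have hd := (hw.differentiableAt (by simp)).hasFDerivAt
  have h2 := (((hd.const_mul r).const_sub 1).const_mul (-2 * r)).smul hw.hasFDerivAt_fderiv_of_two
  simp only [levi, h1.fderiv_eq, h1.self_of_nhds]
  erw [h2.fderiv]
  simp
  ring

end Levi

end LocalHermitianData

/-! ### The maximum principle at one point of the manifold -/

namespace AlmostHermitianStructure

section MaximumPrinciple

set_option maxSynthPendingDepth 3

variable {E : Type*} [NormedAddCommGroup E] [NormedSpace ℝ E] [FiniteDimensional ℝ E]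
  {M : Type*} [TopologicalSpace M] [ChartedSpace E M] [IsManifold 𝓘(ℝ, E) ∞ M]
  [RiemannianBundle (fun x : M ↦ TangentSpace 𝓘(ℝ, E) x)]
  [IsContMDiffRiemannianBundle 𝓘(ℝ, E) ∞ E (fun x : M ↦ TangentSpace 𝓘(ℝ, E) x)]
  {F : Type*} [NormedAddCommGroup F] [NormedSpace ℝ F] [FiniteDimensional ℝ F]
  {N : Type*} [TopologicalSpace N] [ChartedSpace F N] [IsManifold 𝓘(ℝ, F) ∞ N]
  [RiemannianBundle (fun y : N ↦ TangentSpace 𝓘(ℝ, F) y)]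
  [IsContMDiffRiemannianBundle 𝓘(ℝ, F) ∞ F (fun y : N ↦ TangentSpace 𝓘(ℝ, F) y)]
  {S : AlmostHermitianStructure E M} {S' : AlmostHermitianStructure F N} {f : M → N} {p : M}

omit [FiniteDimensional ℝ E]
  [IsContMDiffRiemannianBundle 𝓘(ℝ, E) ∞ E (fun x : M ↦ TangentSpace 𝓘(ℝ, E) x)] in
theorem norm_J (S : AlmostHermitianStructure E M) (v : TangentSpace 𝓘(ℝ, E) p) :
    ‖S.J p v‖ = ‖v‖ := by
  rw [← sq_eq_sq₀ (norm_nonneg _) (norm_nonneg _), ← real_inner_self_eq_norm_sq, S.inner_J,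
    real_inner_self_eq_norm_sq]

/-- This is `max_estimate` for the cutoff `η = (1 - r v)²`, read in charts at `p` and `f p`. The
right side tends to `k₁` as `r` tends to `0`. -/
theorem energy_le_of_eventually_le (hf : IsAlmostHolomorphic S S' f) {k₁ k₂ : ℝ} (hk₁ : 0 ≤ k₁)
    (hM : ∀ v : TangentSpace 𝓘(ℝ, E) p, v ≠ 0 → -k₁ ≤ S.holSecCurvature p v)
    (hN : ∀ w : TangentSpace 𝓘(ℝ, F) (f p), w ≠ 0 → S'.holSecCurvature (f p) w ≤ -k₂)
    {v : M → ℝ} (hv : ContMDiffAt 𝓘(ℝ, E) 𝓘(ℝ, ℝ) 2 v p) {C r : ℝ} (hC : 0 ≤ C) (hr : 0 ≤ r)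
    (hv1 : ∀ X : TangentSpace 𝓘(ℝ, E) p, |mvfderiv 𝓘(ℝ, E) v p X| ≤ C * ‖X‖)
    (hv2 : ∀ X : TangentSpace 𝓘(ℝ, E) p, S.leviForm v p X ≤ C * (2 * ‖X‖ ^ 2))
    (hv0 : 0 ≤ v p) (hvr : 0 < 1 - r * v p) {X : TangentSpace 𝓘(ℝ, E) p} (hX : ‖X‖ = 1)
    (hfX : 0 < ‖mfderiv 𝓘(ℝ, E) 𝓘(ℝ, F) f p X‖)
    (hmax : ∀ᶠ x in nhds p, ∀ w : TangentSpace 𝓘(ℝ, E) x,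
      (1 - r * v x) ^ 2 * ‖mfderiv 𝓘(ℝ, E) 𝓘(ℝ, F) f x w‖ ^ 2 ≤
        (1 - r * v p) ^ 2 * ‖mfderiv 𝓘(ℝ, E) 𝓘(ℝ, F) f p X‖ ^ 2 * ‖w‖ ^ 2) :
    k₂ * ((1 - r * v p) ^ 2 * ‖mfderiv 𝓘(ℝ, E) 𝓘(ℝ, F) f p X‖ ^ 2) ≤
      k₁ + (8 * C ^ 2 * r ^ 2 + 2 * C * r) := by
  have hp := mem_chart_source E p
  have hq := mem_chart_source F (f p)
  set z := extChartAt 𝓘(ℝ, E) p p with hz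
  set a : E := toCoord p p X with ha
  have hXa : ofCoord p p a = X := ofCoord_toCoord hp X
  have hpz : (extChartAt 𝓘(ℝ, E) p).symm z = p := chart_left_inv hp
  set w : E → ℝ := v ∘ (extChartAt 𝓘(ℝ, E) p).symm with hw
  have hwz : w z = v p := by rw [hw, Function.comp_apply, hpz]
  have hwd : ContDiffAt ℝ 2 w z := contDiffAt_comp_extChartAt_symm hv
  have hzU : z ∈ chartDomain E F f p (f p) := by
    refine ⟨extChartAt_mem_target hp, ?_⟩
    rw [Set.mem_preimage, hpz]
    exact hq
  have hfz : inCharts E F f p (f p) z = extChartAt 𝓘(ℝ, F) (f p) (f p) := by rw [inCharts, hpz]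
  have hU : IsOpen (chartDomain E F f p (f p)) := isOpen_chartDomain hf.contMDiff.continuous
  have hJa : ofCoord p p ((S.localData p).J z a) = S.J p X := by
    rw [S.ofCoord_localData_J_self, hXa]
  have hdw (b : E) : fderiv ℝ w z b = mvfderiv 𝓘(ℝ, E) v p (ofCoord p p b) := by
    rw [mvfderiv_eq_fderiv hp (hv.mdifferentiableAt (by simp)), toCoord_ofCoord hp]
  have hlevi : (S.localData p).levi w z a ≤ 2 * C := by
    rw [← S.leviForm_ofCoord hv, hXa]
    have := hv2 X
    rw [hX] at this
    linarith
  have hd1 : (fderiv ℝ w z a) ^ 2 ≤ C ^ 2 := by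
    rw [hdw, hXa, ← sq_abs]
    have := hv1 X
    rw [hX, mul_one] at this
    exact pow_le_pow_left₀ (abs_nonneg _) this 2
  have hd2 : (fderiv ℝ w z ((S.localData p).J z a)) ^ 2 ≤ C ^ 2 := by
    rw [hdw, hJa, ← sq_abs]
    have := hv1 (S.J p X)
    rw [S.norm_J, hX, mul_one] at this
    exact pow_le_pow_left₀ (abs_nonneg _) this 2
  have hGΛ : (S'.localData (f p)).G (inCharts E F f p (f p) z)
      (fderiv ℝ (inCharts E F f p (f p)) z a) (fderiv ℝ (inCharts E F f p (f p)) z a) =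
      ‖mfderiv 𝓘(ℝ, E) 𝓘(ℝ, F) f p X‖ ^ 2 := by
    rw [localData_G_inCharts hf.contMDiff hzU, hpz, hXa, real_inner_self_eq_norm_sq]
  have est := (isHolomorphicOn_inCharts (p := p) (q := f p) hf).max_estimate
    ((S.isHermitianOn_localData p).mono hU Set.inter_subset_left)
    (S'.isHermitianOn_localData (f p)) hzU (η := fun y ↦ (1 - r * w y) ^ 2)
    ((contDiffAt_const.sub (contDiffAt_const.mul hwd)).pow 2)
    (by rw [hwz]; positivity) (a := a) (sq_nonneg ‖mfderiv 𝓘(ℝ, E) 𝓘(ℝ, F) f p X‖)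
    (by rw [S.localData_G_self, hXa, real_inner_self_eq_norm_sq, hX, one_pow]) hGΛ
    (by
      have hc : ContinuousAt (extChartAt 𝓘(ℝ, E) p).symm z := continuousAt_extChartAt_symm p
      have hmax' := hc.eventually (p := fun x ↦ ∀ w : TangentSpace 𝓘(ℝ, E) x,
        (1 - r * v x) ^ 2 * ‖mfderiv 𝓘(ℝ, E) 𝓘(ℝ, F) f x w‖ ^ 2 ≤
        (1 - r * v p) ^ 2 * ‖mfderiv 𝓘(ℝ, E) 𝓘(ℝ, F) f p X‖ ^ 2 * ‖w‖ ^ 2) (by rwa [hpz])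
      filter_upwards [hmax', hU.mem_nhds hzU] with y hy hyU b
      rw [localData_G_inCharts hf.contMDiff hyU, real_inner_self_eq_norm_sq, localData_G_apply,
        real_inner_self_eq_norm_sq, hwz]
      exact hy _)
    (S.le_localData_G_curv hM)
    (by rw [hfz]; exact S'.localData_G_curv_le hN)
  rw [LocalHermitianData.levi_one_sub_mul_sq _ hwd,
    LocalHermitianData.fderiv_one_sub_mul_sq (hwd.differentiableAt (by simp)), hwz] at est
  set m := 1 - r * v p with hm
  set Λ := ‖mfderiv 𝓘(ℝ, E) 𝓘(ℝ, F) f p X‖ ^ 2 with hΛ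
  have hΛ0 : 0 < Λ := by positivity
  have hm1 : m ≤ 1 := by rw [hm]; nlinarith
  set d := (fderiv ℝ w z a) ^ 2
  set d' := (fderiv ℝ w z ((S.localData p).J z a)) ^ 2
  -- The reason for squaring the cutoff: `|dη|² / η` is `4 r² |dw|²`, with no denominator that
  -- degenerates as `m` tends to `0`.
  have e1 : 2 * Λ * (((-2 * r * m) • fderiv ℝ w z) a ^ 2 +
      ((-2 * r * m) • fderiv ℝ w z) ((S.localData p).J z a) ^ 2) / m ^ 2 =
      Λ * (8 * r ^ 2 * (d + d')) := by
    simp only [smul_apply, smul_eq_mul, d, d']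
    field_simp
    ring
  rw [e1] at est
  have e2 : 2 * r * m * (S.localData p).levi w z a ≤ 4 * C * r := by
    calc 2 * r * m * (S.localData p).levi w z a ≤ 2 * r * m * (2 * C) := by gcongr
      _ ≤ 2 * r * 1 * (2 * C) := by gcongr
      _ = 4 * C * r := by ring
  have e3 : 8 * r ^ 2 * (d + d') ≤ 8 * r ^ 2 * (C ^ 2 + C ^ 2) := by gcongr
  have e4 : 0 ≤ 2 * r ^ 2 * (d + d') := by positivity
  have e5 : k₁ * m ^ 2 ≤ k₁ := mul_le_of_le_one_right hk₁ (pow_le_one₀ hvr.le hm1)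
  -- Every term carries a factor `Λ > 0`, which is cancelled next.
  have e6 : Λ * (2 * k₂ * Λ * m ^ 2 + (2 * r ^ 2 * (d + d') -
      2 * r * m * (S.localData p).levi w z a)) ≤ Λ * (8 * r ^ 2 * (d + d') + 2 * k₁ * m ^ 2) := by
    linarith
  have e7 := le_of_mul_le_mul_left e6 hΛ0
  nlinarith

end MaximumPrinciple

end AlmostHermitianStructure

/-! ### The global maximum principle -/

namespace AlmostHermitianStructure

section Global

set_option maxSynthPendingDepth 3

variable {E : Type*} [NormedAddCommGroup E] [NormedSpace ℝ E] [FiniteDimensional ℝ E]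
  {M : Type*} [TopologicalSpace M] [ChartedSpace E M] [IsManifold 𝓘(ℝ, E) ∞ M]
  [RiemannianBundle (fun x : M ↦ TangentSpace 𝓘(ℝ, E) x)]
  [IsContMDiffRiemannianBundle 𝓘(ℝ, E) ∞ E (fun x : M ↦ TangentSpace 𝓘(ℝ, E) x)]
  {F : Type*} [NormedAddCommGroup F] [NormedSpace ℝ F] [FiniteDimensional ℝ F]
  {N : Type*} [TopologicalSpace N] [ChartedSpace F N] [IsManifold 𝓘(ℝ, F) ∞ N]
  [RiemannianBundle (fun y : N ↦ TangentSpace 𝓘(ℝ, F) y)]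
  [IsContMDiffRiemannianBundle 𝓘(ℝ, F) ∞ F (fun y : N ↦ TangentSpace 𝓘(ℝ, F) y)]
  {S : AlmostHermitianStructure E M} {S' : AlmostHermitianStructure F N} {f : M → N} {p : M}

/-- If `|df|² < L |·|²` on nonzero tangent vectors at `p`, the same holds near `p`. -/
theorem eventually_norm_mfderiv_sq_le (hf : IsAlmostHolomorphic S S' f) {L : ℝ}
    (hL : ∀ v : TangentSpace 𝓘(ℝ, E) p, v ≠ 0 →
      ‖mfderiv 𝓘(ℝ, E) 𝓘(ℝ, F) f p v‖ ^ 2 < L * ‖v‖ ^ 2) :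
    ∀ᶠ x in nhds p, ∀ v : TangentSpace 𝓘(ℝ, E) x,
      ‖mfderiv 𝓘(ℝ, E) 𝓘(ℝ, F) f x v‖ ^ 2 ≤ L * ‖v‖ ^ 2 := by
  have hp := mem_chart_source E p
  have hpz : (extChartAt 𝓘(ℝ, E) p).symm (extChartAt 𝓘(ℝ, E) p p) = p := chart_left_inv hp
  have hU : IsOpen (chartDomain E F f p (f p)) := isOpen_chartDomain hf.contMDiff.continuous
  have hpU : extChartAt 𝓘(ℝ, E) p p ∈ chartDomain E F f p (f p) := by
    refine ⟨extChartAt_mem_target hp, ?_⟩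
    rw [Set.mem_preimage, hpz]
    exact mem_chart_source F (f p)
  let g : E → E →L[ℝ] F := fderiv ℝ (inCharts E F f p (f p))
  let h : E × E → ℝ := fun y ↦ L * (S.localData p).G y.1 y.2 y.2 -
    (S'.localData (f p)).G (inCharts E F f p (f p) y.1) (g y.1 y.2) (g y.1 y.2)
  have hval {z : E} (hz : z ∈ chartDomain E F f p (f p)) (b : E) :
      h (z, b) = L * ‖ofCoord p ((extChartAt 𝓘(ℝ, E) p).symm z) b‖ ^ 2 -
        ‖mfderiv 𝓘(ℝ, E) 𝓘(ℝ, F) f ((extChartAt 𝓘(ℝ, E) p).symm z)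
          (ofCoord p ((extChartAt 𝓘(ℝ, E) p).symm z) b)‖ ^ 2 := by
    simp only [h, g]
    rw [localData_G_inCharts hf.contMDiff hz, localData_G_apply, real_inner_self_eq_norm_sq,
      real_inner_self_eq_norm_sq]
  have hcont (b : E) : ContinuousAt h (extChartAt 𝓘(ℝ, E) p p, b) := by
    have c1 : ContinuousAt (S.localData p).G (extChartAt 𝓘(ℝ, E) p p) :=
      ((S.isHermitianOn_localData p).hasFDerivAt_G hpU.1).continuousAt
    have cf := (contDiffOn_inCharts (p := p) (q := f p) hf.contMDiff).contDiffAt (hU.mem_nhds hpU)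
    have c2 : ContinuousAt (S'.localData (f p)).G
        (inCharts E F f p (f p) (extChartAt 𝓘(ℝ, E) p p)) :=
      ((S'.isHermitianOn_localData (f p)).hasFDerivAt_G (extChartAt_mem_target hpU.2)).continuousAt
    have c3 : ContinuousAt g (extChartAt 𝓘(ℝ, E) p p) :=
      (cf.fderiv_right (m := 0) (by simp)).continuousAt
    have d1 : ContinuousAt (fun y : E × E ↦ (S.localData p).G y.1) (extChartAt 𝓘(ℝ, E) p p, b) :=
      ContinuousAt.comp (g := (S.localData p).G) (f := Prod.fst) c1 continuousAt_fst
    have d2 : ContinuousAt (fun y : E × E ↦ (S'.localData (f p)).G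
        (inCharts E F f p (f p) y.1)) (extChartAt 𝓘(ℝ, E) p p, b) :=
      ContinuousAt.comp (g := fun z ↦ (S'.localData (f p)).G (inCharts E F f p (f p) z))
        (f := Prod.fst) (ContinuousAt.comp (g := (S'.localData (f p)).G) c2 cf.continuousAt)
        continuousAt_fst
    have d3 : ContinuousAt (fun y : E × E ↦ g y.1 y.2) (extChartAt 𝓘(ℝ, E) p p, b) :=
      (ContinuousAt.comp (g := g) (f := Prod.fst) c3 continuousAt_fst).clm_apply continuousAt_snd
    exact (continuousAt_const.mul ((d1.clm_apply continuousAt_snd).clm_apply continuousAt_snd)).sub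
      ((d2.clm_apply d3).clm_apply d3)
  -- Compactness of the coordinate unit sphere makes the strict inequality uniform in the direction;
  -- homogeneity then gives all vectors.
  have key : ∀ᶠ z in nhds (extChartAt 𝓘(ℝ, E) p p), ∀ b ∈ Metric.sphere (0 : E) 1,
      0 < h (z, b) := by
    refine (isCompact_sphere (0 : E) 1).eventually_forall_of_forall_eventually fun b hb ↦ ?_
    refine (hcont b).eventually (lt_mem_nhds ?_)
    rw [hval hpU, hpz, sub_pos]
    refine hL _ fun h0 ↦ ?_
    have : b = 0 := by rw [← toCoord_ofCoord hp b, h0, map_zero]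
    simp [this] at hb
  have hc : ContinuousAt (extChartAt 𝓘(ℝ, E) p) p := continuousAt_extChartAt p
  filter_upwards [hc.eventually key, hc.eventually (hU.mem_nhds hpU),
    (chartAt E p).open_source.mem_nhds hp] with x hx hxU hxp v
  by_cases hv : v = 0
  · simp [hv]
  set b : E := toCoord p x v with hb
  have hbv : ofCoord p x b = v := ofCoord_toCoord hxp v
  have hb0 : b ≠ 0 := fun h0 ↦ hv (by rw [← hbv, h0, map_zero])
  have h1 := hx (‖b‖⁻¹ • b) (by simp [norm_smul, hb0])
  rw [hval hxU, chart_left_inv hxp, map_smul, hbv, map_smul, norm_smul, norm_smul, mul_pow,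
    mul_pow, mul_left_comm, ← mul_sub] at h1
  have h2 := (pos_iff_pos_of_mul_pos h1).1 (pow_pos (norm_pos_iff.2 (inv_ne_zero
    (norm_ne_zero_iff.2 hb0))) 2)
  linarith

theorem exists_norm_eq_one_and_norm_apply_eq {V W : Type*} [NormedAddCommGroup V]
    [NormedSpace ℝ V] [FiniteDimensional ℝ V] [Nontrivial V] [NormedAddCommGroup W]
    [NormedSpace ℝ W] (A : V →L[ℝ] W) : ∃ v, ‖v‖ = 1 ∧ ∀ w, ‖A w‖ ≤ ‖A v‖ * ‖w‖ := by
  have := FiniteDimensional.proper_real V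
  obtain ⟨v, hv, hmax⟩ := (isCompact_sphere (0 : V) 1).exists_isMaxOn
    (NormedSpace.sphere_nonempty.2 zero_le_one) (f := fun v ↦ ‖A v‖) (by fun_prop)
  refine ⟨v, by simpa using hv, fun w ↦ ?_⟩
  by_cases hw : w = 0
  · simp [hw]
  have h1 : ‖A (‖w‖⁻¹ • w)‖ ≤ ‖A v‖ := hmax (by simp [norm_smul, hw])
  rw [map_smul, norm_smul, norm_inv, norm_norm, inv_mul_le_iff₀ (norm_pos_iff.2 hw)] at h1
  linarith

/-- The largest value of `|df(v)|²` over unit tangent vectors `v` at `x`. -/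
noncomputable def energy (E F : Type*) [NormedAddCommGroup E] [NormedSpace ℝ E]
    [NormedAddCommGroup F] [NormedSpace ℝ F] {M N : Type*} [TopologicalSpace M] [ChartedSpace E M]
    [TopologicalSpace N] [ChartedSpace F N] [IsManifold 𝓘(ℝ, E) ∞ M] [IsManifold 𝓘(ℝ, F) ∞ N]
    [RiemannianBundle (fun x : M ↦ TangentSpace 𝓘(ℝ, E) x)]
    [RiemannianBundle (fun y : N ↦ TangentSpace 𝓘(ℝ, F) y)] (f : M → N) (x : M) : ℝ :=
  ‖mfderiv 𝓘(ℝ, E) 𝓘(ℝ, F) f x‖ ^ 2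

omit [FiniteDimensional ℝ E] [FiniteDimensional ℝ F]
  [IsContMDiffRiemannianBundle 𝓘(ℝ, E) ∞ E (fun x : M ↦ TangentSpace 𝓘(ℝ, E) x)]
  [IsContMDiffRiemannianBundle 𝓘(ℝ, F) ∞ F (fun y : N ↦ TangentSpace 𝓘(ℝ, F) y)] in
theorem norm_mfderiv_sq_le_energy (x : M) (v : TangentSpace 𝓘(ℝ, E) x) :
    ‖mfderiv 𝓘(ℝ, E) 𝓘(ℝ, F) f x v‖ ^ 2 ≤ energy E F f x * ‖v‖ ^ 2 := by
  rw [energy, ← mul_pow]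
  exact pow_le_pow_left₀ (norm_nonneg _) (ContinuousLinearMap.le_opNorm _ _) 2

omit [FiniteDimensional ℝ E] [FiniteDimensional ℝ F]
  [IsContMDiffRiemannianBundle 𝓘(ℝ, E) ∞ E (fun x : M ↦ TangentSpace 𝓘(ℝ, E) x)]
  [IsContMDiffRiemannianBundle 𝓘(ℝ, F) ∞ F (fun y : N ↦ TangentSpace 𝓘(ℝ, F) y)] in
theorem energy_le {L : ℝ} (hL : 0 ≤ L) {x : M} (h : ∀ v : TangentSpace 𝓘(ℝ, E) x,
    ‖mfderiv 𝓘(ℝ, E) 𝓘(ℝ, F) f x v‖ ^ 2 ≤ L * ‖v‖ ^ 2) : energy E F f x ≤ L := by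
  rw [energy, ← Real.le_sqrt (norm_nonneg _) hL]
  refine ContinuousLinearMap.opNorm_le_bound _ (Real.sqrt_nonneg _) fun v ↦ ?_
  rw [← sq_le_sq₀ (norm_nonneg _) (by positivity), mul_pow, Real.sq_sqrt hL]
  exact h v

omit [FiniteDimensional ℝ E] [FiniteDimensional ℝ F]
  [IsContMDiffRiemannianBundle 𝓘(ℝ, E) ∞ E (fun x : M ↦ TangentSpace 𝓘(ℝ, E) x)]
  [IsContMDiffRiemannianBundle 𝓘(ℝ, F) ∞ F (fun y : N ↦ TangentSpace 𝓘(ℝ, F) y)] in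
theorem energy_nonneg (x : M) : 0 ≤ energy E F f x := sq_nonneg _

theorem eventually_energy_le (hf : IsAlmostHolomorphic S S' f) {L : ℝ}
    (hL : energy E F f p < L) : ∀ᶠ x in nhds p, energy E F f x ≤ L := by
  have h := eventually_norm_mfderiv_sq_le (p := p) hf (L := L) fun v hv ↦
    (norm_mfderiv_sq_le_energy p v).trans_lt
      (mul_lt_mul_of_pos_right hL (pow_pos (norm_pos_iff.2 hv) 2))
  filter_upwards [h] with x hx
  exact energy_le ((energy_nonneg p).trans hL.le) hx

/-- Upper semicontinuity is all that is needed for a maximum on a compact set, and it follows from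
the one-sided bound `eventually_energy_le`. -/
theorem upperSemicontinuous_mul_energy (hf : IsAlmostHolomorphic S S' f) {w : M → ℝ}
    (hw : Continuous w) (hw0 : ∀ x, 0 ≤ w x) :
    UpperSemicontinuous (fun x ↦ w x * energy E F f x) := by
  intro p c hc
  have h1 : ∀ᶠ L in nhdsWithin (energy E F f p) (Set.Ioi (energy E F f p)), w p * L < c := by
    have hcont : Continuous fun L ↦ w p * L := by fun_prop
    exact (hcont.continuousAt.eventually (gt_mem_nhds hc)).filter_mono nhdsWithin_le_nhds
  obtain ⟨L, hL, hL'⟩ := (h1.and self_mem_nhdsWithin).exists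
  filter_upwards [eventually_energy_le hf hL',
    (hw.mul continuous_const).continuousAt.eventually (gt_mem_nhds hL)] with x hx hx'
  exact (mul_le_mul_of_nonneg_left hx (hw0 x)).trans_lt hx'

omit [FiniteDimensional ℝ F]
  [IsContMDiffRiemannianBundle 𝓘(ℝ, E) ∞ E (fun x : M ↦ TangentSpace 𝓘(ℝ, E) x)]
  [IsContMDiffRiemannianBundle 𝓘(ℝ, F) ∞ F (fun y : N ↦ TangentSpace 𝓘(ℝ, F) y)] in
theorem exists_norm_eq_one_and_energy_eq (hp : energy E F f p ≠ 0) :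
    ∃ X : TangentSpace 𝓘(ℝ, E) p, ‖X‖ = 1 ∧
      ‖mfderiv 𝓘(ℝ, E) 𝓘(ℝ, F) f p X‖ ^ 2 = energy E F f p := by
  have : FiniteDimensional ℝ (TangentSpace 𝓘(ℝ, E) p) := inferInstanceAs (FiniteDimensional ℝ E)
  have : Nontrivial (TangentSpace 𝓘(ℝ, E) p) := by
    by_contra h
    rw [not_nontrivial_iff_subsingleton] at h
    refine hp (le_antisymm (energy_le le_rfl fun v ↦ ?_) (energy_nonneg p))
    simp [Subsingleton.elim v 0]
  obtain ⟨X, hX, h⟩ := exists_norm_eq_one_and_norm_apply_eq (mfderiv 𝓘(ℝ, E) 𝓘(ℝ, F) f p)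
  refine ⟨X, hX, le_antisymm ?_ (energy_le (sq_nonneg _) fun v ↦ ?_)⟩
  · simpa [hX] using norm_mfderiv_sq_le_energy (F := F) (f := f) p X
  · rw [← mul_pow]
    exact pow_le_pow_left₀ (norm_nonneg _) (h v) 2

/-- For each small `r` the maximum of `(1 - r u)² · energy` over `{u ≤ 1/r}` dominates the value at
`x` and is bounded by the pointwise estimate; then `r` tends to `0` with `x` fixed. -/
theorem mul_energy_le (hf : IsAlmostHolomorphic S S' f) {k₁ k₂ : ℝ} (hk₁ : 0 ≤ k₁) (hk₂ : 0 < k₂)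
    (hM : ∀ (x : M) (v : TangentSpace 𝓘(ℝ, E) x), v ≠ 0 → -k₁ ≤ S.holSecCurvature x v)
    (hN : ∀ (y : N) (w : TangentSpace 𝓘(ℝ, F) y), w ≠ 0 → S'.holSecCurvature y w ≤ -k₂)
    {u : M → ℝ} (hu : S.IsTamedExhaustion u) (x : M) : k₂ * energy E F f x ≤ k₁ := by
  obtain ⟨C, hC, htame⟩ := hu.tamed
  have key : ∀ᶠ r in nhdsWithin (0 : ℝ) (Set.Ioi 0),
      k₂ * ((1 - r * u x) ^ 2 * energy E F f x) ≤ k₁ + (8 * C ^ 2 * r ^ 2 + 2 * C * r) := by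
    have hsmall : ∀ᶠ r in nhdsWithin (0 : ℝ) (Set.Ioi 0), 0 < 1 - r * u x := by
      have hcont : Continuous fun r : ℝ ↦ 1 - r * u x := by fun_prop
      exact (hcont.continuousAt.eventually (lt_mem_nhds (by simp))).filter_mono nhdsWithin_le_nhds
    filter_upwards [hsmall, self_mem_nhdsWithin] with r hrx hr
    have hr : 0 < r := hr
    obtain h0 | hpos := (energy_nonneg (E := E) (F := F) (f := f) x).eq_or_lt
    · rw [← h0, mul_zero, mul_zero]
      positivity
    have hxK : x ∈ u ⁻¹' Set.Iic r⁻¹ := by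
      rw [Set.mem_preimage, Set.mem_Iic, ← one_div, le_div_iff₀ hr]
      linarith
    obtain ⟨p, hpK, hpmax⟩ := UpperSemicontinuousOn.exists_isMaxOn ⟨x, hxK⟩ (hu.proper r⁻¹)
      ((upperSemicontinuous_mul_energy hf (w := fun y ↦ (1 - r * u y) ^ 2)
        (by have := hu.continuous; fun_prop) fun _ ↦ sq_nonneg _).upperSemicontinuousOn _)
    have hxp : (1 - r * u x) ^ 2 * energy E F f x ≤ (1 - r * u p) ^ 2 * energy E F f p :=
      hpmax hxK
    have hpp : 0 < (1 - r * u p) ^ 2 * energy E F f p := lt_of_lt_of_le (by positivity) hxp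
    have hE : energy E F f p ≠ 0 := right_ne_zero_of_mul hpp.ne'
    -- The maximum is positive, so it is not attained where the cutoff vanishes.
    have hup : 0 < 1 - r * u p := by
      refine lt_of_le_of_ne ?_ fun h ↦ ?_
      · rw [Set.mem_preimage, Set.mem_Iic, ← one_div, le_div_iff₀ hr] at hpK
        linarith
      · rw [← h] at hpp
        simp at hpp
    obtain ⟨X, hX, hfX⟩ := exists_norm_eq_one_and_energy_eq hE
    obtain ⟨V, v, hV, hpV, hv, huv, hvp, hv1, hv2⟩ := htame p
    have hvd : ContMDiffAt 𝓘(ℝ, E) 𝓘(ℝ, ℝ) 2 v p := hv.contMDiffAt (hV.mem_nhds hpV)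
    have est := energy_le_of_eventually_le hf hk₁ (hM p) (hN (f p)) hvd hC.le hr.le hv1 hv2
      (by rw [hvp]; exact hu.nonneg p) (by rwa [hvp]) hX
      (norm_pos_iff.2 fun h ↦ hE (by rw [← hfX, h, norm_zero, zero_pow two_ne_zero]))
      (by
        -- Positivity near `p` serves twice: it lets `1 - r v ≤ 1 - r u` be squared, and it keeps
        -- `y` in the set over which `p` is a maximum.
        have hvpos : ∀ᶠ y in nhds p, 0 < 1 - r * v y :=
          (continuousAt_const.sub (continuousAt_const.mul hvd.continuousAt)).eventually
            (lt_mem_nhds (by simpa [hvp] using hup))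
        filter_upwards [hvpos, hV.mem_nhds hpV] with y hy hyV w
        have h1 : 1 - r * v y ≤ 1 - r * u y := by
          have := mul_le_mul_of_nonneg_left (huv y hyV) hr.le
          linarith
        have hyK : y ∈ u ⁻¹' Set.Iic r⁻¹ := by
          rw [Set.mem_preimage, Set.mem_Iic, ← one_div, le_div_iff₀ hr]
          linarith
        have h2 : (1 - r * u y) ^ 2 * energy E F f y ≤ (1 - r * u p) ^ 2 * energy E F f p :=
          hpmax hyK
        rw [hfX, hvp]
        calc (1 - r * v y) ^ 2 * ‖mfderiv 𝓘(ℝ, E) 𝓘(ℝ, F) f y w‖ ^ 2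
            ≤ (1 - r * u y) ^ 2 * (energy E F f y * ‖w‖ ^ 2) :=
              mul_le_mul (pow_le_pow_left₀ hy.le h1 2) (norm_mfderiv_sq_le_energy y w)
                (sq_nonneg _) (sq_nonneg _)
          _ = (1 - r * u y) ^ 2 * energy E F f y * ‖w‖ ^ 2 := by ring
          _ ≤ _ := mul_le_mul_of_nonneg_right h2 (sq_nonneg _))
    rw [hfX, hvp] at est
    exact (mul_le_mul_of_nonneg_left hxp hk₂.le).trans est
  have l1 : Filter.Tendsto (fun r : ℝ ↦ k₂ * ((1 - r * u x) ^ 2 * energy E F f x))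
      (nhdsWithin 0 (Set.Ioi 0)) (nhds (k₂ * ((1 - 0 * u x) ^ 2 * energy E F f x))) :=
    (Continuous.tendsto (by fun_prop) 0).mono_left nhdsWithin_le_nhds
  have l2 : Filter.Tendsto (fun r : ℝ ↦ k₁ + (8 * C ^ 2 * r ^ 2 + 2 * C * r))
      (nhdsWithin 0 (Set.Ioi 0)) (nhds (k₁ + (8 * C ^ 2 * 0 ^ 2 + 2 * C * 0))) :=
    (Continuous.tendsto (by fun_prop) 0).mono_left nhdsWithin_le_nhds
  simpa using le_of_tendsto_of_tendsto l1 l2 key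

end Global

/-! ### Maps with vanishing differential -/

section LocallyConstant

variable {E : Type*} [NormedAddCommGroup E] [NormedSpace ℝ E]
  {M : Type*} [TopologicalSpace M] [ChartedSpace E M] [IsManifold 𝓘(ℝ, E) ∞ M]
  {F : Type*} [NormedAddCommGroup F] [NormedSpace ℝ F]
  {N : Type*} [TopologicalSpace N] [ChartedSpace F N] [IsManifold 𝓘(ℝ, F) ∞ N] {f : M → N}

theorem isLocallyConstant_of_mfderiv_eq_zero (hf : ContMDiff 𝓘(ℝ, E) 𝓘(ℝ, F) ∞ f)
    (h : ∀ x, mfderiv 𝓘(ℝ, E) 𝓘(ℝ, F) f x = 0) : IsLocallyConstant f := by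
  rw [IsLocallyConstant.iff_eventually_eq]
  intro p
  have hp := mem_chart_source E p
  have hpz : (extChartAt 𝓘(ℝ, E) p).symm (extChartAt 𝓘(ℝ, E) p p) = p := chart_left_inv hp
  have hU : IsOpen (chartDomain E F f p (f p)) := isOpen_chartDomain hf.continuous
  have hpU : extChartAt 𝓘(ℝ, E) p p ∈ chartDomain E F f p (f p) := by
    refine ⟨extChartAt_mem_target hp, ?_⟩
    rw [Set.mem_preimage, hpz]
    exact mem_chart_source F (f p)
  obtain ⟨ε, hε, hball⟩ := Metric.isOpen_iff.1 hU _ hpU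
  have hd : DifferentiableOn ℝ (inCharts E F f p (f p))
      (Metric.ball (extChartAt 𝓘(ℝ, E) p p) ε) :=
    ((contDiffOn_inCharts hf).differentiableOn (by simp)).mono hball
  have hc : ContinuousAt (extChartAt 𝓘(ℝ, E) p) p := continuousAt_extChartAt p
  filter_upwards [hc.eventually (Metric.ball_mem_nhds _ hε),
    (chartAt E p).open_source.mem_nhds hp] with x hx hxp
  have hx' : f x ∈ (chartAt F (f p)).source := by
    have := (hball hx).2
    rwa [Set.mem_preimage, chart_left_inv hxp] at this
  have e : inCharts E F f p (f p) (extChartAt 𝓘(ℝ, E) p x) =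
      inCharts E F f p (f p) (extChartAt 𝓘(ℝ, E) p p) := by
    refine (convex_ball _ _).is_const_of_fderivWithin_eq_zero hd (fun z hz ↦ ?_) hx
      (Metric.mem_ball_self hε)
    rw [fderivWithin_of_isOpen Metric.isOpen_ball hz]
    ext a
    rw [fderiv_inCharts hf (hball hz), h]
    exact map_zero _
  rw [inCharts, inCharts, chart_left_inv hxp, hpz] at e
  rw [← chart_left_inv hx', e, chart_left_inv (mem_chart_source F (f p))]

end LocallyConstant

end AlmostHermitianStructure

/-! ### The Schwarz lemma and its Liouville consequence -/

theorem theorem1p2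
    {E : Type*} [NormedAddCommGroup E] [NormedSpace ℝ E] [FiniteDimensional ℝ E]
    {M : Type*} [TopologicalSpace M] [T2Space M] [ChartedSpace E M] [IsManifold 𝓘(ℝ, E) ∞ M]
    [RiemannianBundle (fun x : M ↦ TangentSpace 𝓘(ℝ, E) x)]
    [IsContMDiffRiemannianBundle 𝓘(ℝ, E) ∞ E (fun x : M ↦ TangentSpace 𝓘(ℝ, E) x)]
    (S : AlmostHermitianStructure E M)
    {F : Type*} [NormedAddCommGroup F] [NormedSpace ℝ F] [FiniteDimensional ℝ F]
    {N : Type*} [TopologicalSpace N] [T2Space N] [ChartedSpace F N] [IsManifold 𝓘(ℝ, F) ∞ N]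
    [RiemannianBundle (fun y : N ↦ TangentSpace 𝓘(ℝ, F) y)]
    [IsContMDiffRiemannianBundle 𝓘(ℝ, F) ∞ F (fun y : N ↦ TangentSpace 𝓘(ℝ, F) y)]
    (S' : AlmostHermitianStructure F N)
    (k₁ k₂ : ℝ) (hk₁ : 0 ≤ k₁) (hk₂ : 0 < k₂)
    (hM : ∀ (x : M) (v : TangentSpace 𝓘(ℝ, E) x), v ≠ 0 → -k₁ ≤ S.holSecCurvature x v)
    (hN : ∀ (y : N) (w : TangentSpace 𝓘(ℝ, F) y), w ≠ 0 → S'.holSecCurvature y w ≤ -k₂)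
    (hu : ∃ u : M → ℝ, S.IsTamedExhaustion u) :
    (∀ f : M → N, IsAlmostHolomorphic S S' f → ∀ (x : M) (v : TangentSpace 𝓘(ℝ, E) x),
      inner ℝ (mfderiv 𝓘(ℝ, E) 𝓘(ℝ, F) f x v) (mfderiv 𝓘(ℝ, E) 𝓘(ℝ, F) f x v) ≤
        k₁ / k₂ * inner ℝ v v) ∧
    (k₁ = 0 → PreconnectedSpace M → ∀ f : M → N, IsAlmostHolomorphic S S' f →
      ∀ x y : M, f x = f y) := by
  obtain ⟨u, hu⟩ := hu
  have main : ∀ f : M → N, IsAlmostHolomorphic S S' f → ∀ (x : M) (v : TangentSpace 𝓘(ℝ, E) x),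
      inner ℝ (mfderiv 𝓘(ℝ, E) 𝓘(ℝ, F) f x v) (mfderiv 𝓘(ℝ, E) 𝓘(ℝ, F) f x v) ≤
        k₁ / k₂ * inner ℝ v v := by
    intro f hf x v
    rw [real_inner_self_eq_norm_sq, real_inner_self_eq_norm_sq]
    refine (AlmostHermitianStructure.norm_mfderiv_sq_le_energy x v).trans ?_
    refine mul_le_mul_of_nonneg_right ?_ (sq_nonneg _)
    rw [le_div_iff₀' hk₂]
    exact AlmostHermitianStructure.mul_energy_le hf hk₁ hk₂ hM hN hu x
  refine ⟨main, fun h0 _ f hf x y ↦ ?_⟩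
  refine (AlmostHermitianStructure.isLocallyConstant_of_mfderiv_eq_zero hf.contMDiff
    fun z ↦ ?_).apply_eq_of_preconnectedSpace x y
  ext v
  have h := main f hf z v
  rw [h0, zero_div, zero_mul] at h
  rw [real_inner_self_eq_norm_sq] at h
  exact norm_eq_zero.1 (pow_eq_zero_iff two_ne_zero |>.1 (le_antisymm h (sq_nonneg _)))
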